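/- **Theorem 3.5.** All hypergraphs are finite, without repeated edges. The *Zagreb index* of a hypergraph is the sum of the squares of the degrees of its vertices. A hypergraph is *linear* if any two distinct edges share at most one vertex; its *girth* is the minimum length of its hypercycles. A connected $k$-uniform hypergraph with $n$ vertices and $m$ edges is *bicyclic* if $n = m(k-1)-1$. A *$k$-uniform hyperpath* $(u_1,e_1,u_2,\dots,e_p,u_{p+1})$ of length $p$ consists of $k$-sets $e_1,\dots,e_p$ with $e_i\cap e_{i+1}=\{u_{i+1}\}$ for $1\le i<p$ and $e_i\cap e_j=\emptyset$ for $|i-j|>1$, together with vertices $u_1\in e_1$, $u_{p+1}\in e_p$ such that $u_1,\dots,u_{p+1}$ are distinct. Let $P_p=(u_1,e_1,\dots,e_p,u_{p+1})$, $P_q=(v_1,f_1,\dots,f_q,v_{q+1})$ and $P_l=(w_1,g_1,\dots,g_l,w_{l+1})$ be disjoint $k$-uniform hyperpaths, and put $t=m-p-q-l\ge 0$ and $n=m(k-1)-1$. Let $C^k_{1,n,p,q,l}(t)$ be the hypergraph obtained by identifying $u_1,v_1,w_1$ to one vertex, identifying $u_{p+1},v_{q+1},w_{l+1}$ to one vertex,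 and then attaching $t$ pendant edges (new edges of $k$ vertices, $k-1$ of them new) at the vertex $u_1=v_1=w_1$. Let $C^k_{2,n,p,q,l}(t)$ be the hypergraph obtained by identifying $u_1,v_1,w_1$ to one vertex, identifying $u_{p+1}$ with $v_{q+1}$, identifying $w_{l+1}$ with a vertex of $f_q\setminus\{v_q,v_{q+1}\}$, and then attaching $t$ pendant edges at the vertex $u_1=v_1=w_1$. Let $k\ge 3$, let $m$ and $n$ be natural numbers with $n=m(k-1)-1$, and let $g\ge 3$ with $m\ge 2g$. 1. If $g$ is even, then $C^k_{1,n,g/2,g/2,g/2}\left(m-\tfrac{3g}{2}\right)$ is a linear bicyclic $k$-uniform hypergraph with $n$ vertices, $m$ edges and girth $g$, it has the maximum Zagreb index among all such hypergraphs, and it is, up to isomorphism, the only one that attains this maximum. 2. If $g$ is odd, then $C^k_{2,n,\lfloor g/2\rfloor,\lceil g/2\rceil,\lfloor g/2\rfloor}\left(m-g-\lfloor g/2\rfloor\right)$ is a linear bicyclic $k$-uniform hypergraph with $n$ vertices, $m$ edges and girth $g$, it has the maximum Zagreb index among all such hypergraphs, and it is, up to isomorphism, the only one that attains this maximum. Moreover,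 let $k\ge 3$, $m\ge 6$ and $n=m(k-1)-1$. Then $C^k_{2,n,1,2,1}(m-4)$ is a linear bicyclic $k$-uniform hypergraph with $n$ vertices and $m$ edges, it has the maximum Zagreb index among all linear bicyclic $k$-uniform hypergraphs with $n$ vertices and $m$ edges (of any girth), and it is, up to isomorphism, the only one that attains this maximum. -/

import Mathlib

open scoped Hypergraph

namespace Hypergraph

/-- Every edge has exactly `k` vertices. -/
def IsUniform {α : Type*} (H : Hypergraph α) (k : ℕ) : Prop :=
  ∀ e ∈ E(H), e.encard = k

/-- Any two distinct edges meet in at most one vertex. -/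
def IsLinear {α : Type*} (H : Hypergraph α) : Prop :=
  ∀ e ∈ E(H), ∀ f ∈ E(H), e ≠ f → (e ∩ f).Subsingleton

/-- There is a vertex, and any two vertices are joined by a walk. -/
def IsConnected {α : Type*} (H : Hypergraph α) : Prop :=
  V(H).Nonempty ∧ ∀ x ∈ V(H), ∀ y ∈ V(H), Relation.ReflTransGen H.Adj x y

/-- The number of edges containing the vertex `v`. -/
noncomputable def degree {α : Type*} (H : Hypergraph α) (v : α) : ℕ :=
  {e | e ∈ E(H) ∧ v ∈ e}.ncard

/-- The Zagreb index of a (finite) hypergraph: the sum of the squares of the degrees of its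
vertices. -/
noncomputable def zagreb {α : Type*} (H : Hypergraph α) : ℕ :=
  ∑ᶠ v ∈ V(H), H.degree v ^ 2

/-- A `k`-uniform bicyclic hypergraph with `n` vertices and `m` edges: it is connected and
`n = m (k - 1) - 1`. -/
structure IsBicyclic {α : Type*} (H : Hypergraph α) (k n m : ℕ) : Prop where
  isUniform : H.IsUniform k
  isConnected : H.IsConnected
  encard_vertexSet : V(H).encard = n
  encard_edgeSet : E(H).encard = m
  card_eq : (n : ℤ) = m * (k - 1) - 1

/-- `H` has a hypercycle `(v 0, e 0, v 1, e 1, …, v (l - 1), e (l - 1), v 0)` of length `l ≥ 2`,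
with distinct vertices and distinct edges, where `v i` and its cyclic successor lie in `e i`. -/
def HasHypercycle {α : Type*} (H : Hypergraph α) (l : ℕ) : Prop :=
  2 ≤ l ∧ ∃ (v : ℕ → α) (e : ℕ → Set α),
    Set.InjOn v (Set.Iio l) ∧ Set.InjOn e (Set.Iio l) ∧
    ∀ i < l, e i ∈ E(H) ∧ v i ∈ e i ∧ v ((i + 1) % l) ∈ e i

/-- `H` has a hypercycle, and the minimum length of its hypercycles is `g`. -/
def HasGirth {α : Type*} (H : Hypergraph α) (g : ℕ) : Prop :=
  IsLeast {l | H.HasHypercycle l} g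

/-- Isomorphism: a bijection of the vertex sets under which the edges correspond. -/
def IsIso {α β : Type*} (H : Hypergraph α) (H' : Hypergraph β) : Prop :=
  ∃ φ : V(H) ≃ V(H'), ∀ s : Set V(H),
    Subtype.val '' s ∈ E(H) ↔ Subtype.val '' (φ '' s) ∈ E(H')

/-- The disjoint union of `k`-uniform hyperpaths whose lengths are the entries of the list `L`.
The vertices of the `a`-th path, of length `L[a]`, are `(a, 0), …, (a, L[a] * (k - 1))` in this
order; its `j`-th edge (`j < L[a]`) consists of the `k` consecutive vertices from
`(a, j * (k - 1))` to `(a, (j + 1) * (k - 1))`, so that consecutive edges share exactly one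
vertex. -/
def disjointPaths (k : ℕ) (L : List ℕ) : Hypergraph (ℕ × ℕ) where
  vertexSet := {x | ∃ h : x.1 < L.length, x.2 ≤ L[x.1] * (k - 1)}
  edgeSet := {e | ∃ (a j : ℕ) (h : a < L.length), j < L[a] ∧
    e = {x | x.1 = a ∧ j * (k - 1) ≤ x.2 ∧ x.2 ≤ (j + 1) * (k - 1)}}
  subset_vertexSet_of_mem_edgeSet' := by
    rintro e ⟨a, j, h, hj, rfl⟩ ⟨b, i⟩ ⟨rfl, -, hi⟩
    exact ⟨h, hi.trans (Nat.mul_le_mul_right _ hj)⟩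

/-- The hypergraph `C₁` with parameters `p, q, l` and with `t` pendant edges attached at a vertex
of degree three. It arises from the disjoint union of hyperpaths of lengths `p, q, l` and `t`
further single edges (hyperpaths of length one) by identifying the first vertices of all of them
and by identifying the last vertices of the first three. -/
def thetaC₁ (k p q l t : ℕ) : Hypergraph (ℕ × ℕ) :=
  (disjointPaths k ([p, q, l] ++ List.replicate t 1)).image fun x ↦
    if x.2 = 0 then (0, 0)
    else if x = (1, q * (k - 1)) ∨ x = (2, l * (k - 1)) then (0, p * (k - 1))
    else x

/-- The hypergraph `C₂` with parameters `p, q, l` and with `t` pendant edges attached at the vertex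
of degree three. It arises from the disjoint union of hyperpaths of lengths `p, q, l` and `t`
further single edges (hyperpaths of length one) by identifying the first vertices of all of them,
by identifying the last vertices of the first two, and by identifying the last vertex of the third
with a vertex of the last edge of the second path other than `(1, (q - 1) * (k - 1))` and
`(1, q * (k - 1))`, the two path vertices of that edge (`k ≥ 3` and `q ≥ 1` are intended). -/
def thetaC₂ (k p q l t : ℕ) : Hypergraph (ℕ × ℕ) :=
  (disjointPaths k ([p, q, l] ++ List.replicate t 1)).image fun x ↦
    if x.2 = 0 then (0, 0)
    else if x = (1, q * (k - 1)) then (0, p * (k - 1))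
    else if x = (2, l * (k - 1)) then (1, (q - 1) * (k - 1) + 1)
    else x

end Hypergraph

/-! Write X for the sum of (d(v) - 1)^2 over the vertices. In a connected k-uniform hypergraph with
n = m(k-1) - 1 the sum of d(v) - 1 is m + 1, so the Zagreb index is X + 2(m + 1) + n and only X has
to be maximized.

A smallest edge set C whose excess (the sum of the truncated d_C(v) - 1) is at least |C| + 1 is a
core: every edge of C has at least two vertices of C-degree at least 2. Double counting gives the
sum of (d_C(v) - 2) plus the sum of (branch - 2) equal to 2 (`IsCore.sum_add_sum`), so the core
branches in very few ways. The t = m - |C| other edges contribute exactly t to the excess. By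
convexity X is largest when all of this falls on one vertex of maximal core degree (`sum_add_sq_le`,
with equality in `exists_of_sum_add_sq_eq`).

A small core is therefore best, and girth bounds its size from below. In the incidence graph,
non-backtracking walks from a branching node stay disjoint while their lengths add up to less than
2g (`IsStar.eq_of_eq`), as in the Moore bound. Comparing the possible branchings in
`sum_sq_le_and_exists_isExtremal` leaves |C| = ⌊3g/2⌋, with the surplus at a vertex of core degree
3.

At equality the core has 3g - 1 nodes. Three walks of length g - 1 from the degree-three vertex use
3g - 2 of them, so all three must meet in the one remaining node at step g
(`IsStar.exists_eq_joint`). The incidence graph is thus three paths of length g with common ends.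
The second end is a vertex if g is even, which gives C₁, and an edge if g is odd, which gives C₂;
`IsTheta` treats both at once. Equal labellings yield isomorphic hypergraphs (`IsTheta.isIso`).

The bound uses only that the girth is at least g. Linear hypergraphs have no hypercycle of length 2,
so g = 3 settles the statement for arbitrary girth. -/

namespace Incidence

/-! ### Excess, cores, and the convexity estimate. -/

open Finset
open scoped Classical

variable {V E : Type*} {I : V → E → Prop} {C : Finset E} {e : E} {v : V}

/-- The number of edges in `C` incident with `v`. -/
noncomputable def deg (I : V → E → Prop) (C : Finset E) (v : V) : ℕ := #{e ∈ C | I v e}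

lemma deg_mono {D : Finset E} (h : C ⊆ D) (v : V) : deg I C v ≤ deg I D v :=
  card_le_card (filter_subset_filter _ h)

lemma deg_insert (he : e ∉ C) (v : V) :
    deg I (insert e C) v = deg I C v + if I v e then 1 else 0 := by
  unfold deg
  rw [filter_insert]
  split_ifs with h
  · rw [card_insert_of_notMem (by simp [he])]
  · rfl

lemma deg_pos_iff : 0 < deg I C v ↔ ∃ e ∈ C, I v e := by
  simp [deg, card_pos, Finset.Nonempty]

variable [Fintype V]

/-- The number of vertices of `e` that lie in at least two edges of `C`. -/
noncomputable def branch (I : V → E → Prop) (C : Finset E) (e : E) : ℕ :=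
  #{v | I v e ∧ 2 ≤ deg I C v}

/-- The sum over the covered vertices of the degree minus one. -/
noncomputable def excess (I : V → E → Prop) (C : Finset E) : ℕ := ∑ v, (deg I C v - 1)

/-- The first edge at a vertex costs nothing because of truncated subtraction; each later one adds
1. -/
lemma excess_insert (he : e ∉ C) :
    excess I (insert e C) = excess I C + #{v | I v e ∧ 0 < deg I C v} := by
  unfold excess
  rw [card_filter, ← sum_add_distrib]
  refine sum_congr rfl fun v _ ↦ ?_
  rw [deg_insert he]
  split_ifs <;> grind

lemma excess_erase (he : e ∈ C) : excess I C = excess I (C.erase e) + branch I C e := by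
  conv_lhs => rw [← insert_erase he]
  rw [excess_insert (notMem_erase e C), branch]
  congr 2
  refine filter_congr fun v _ ↦ and_congr_right fun hv ↦ ?_
  conv_rhs => rw [← insert_erase he]
  rw [deg_insert (notMem_erase e C), if_pos hv]
  omega

/-- Every nonempty proper set of edges shares a vertex with an edge outside of it. -/
def Connected [Fintype E] (I : V → E → Prop) : Prop :=
  ∀ C : Finset E, C.Nonempty → C ≠ univ → ∃ e ∉ C, ∃ v, I v e ∧ 0 < deg I C v

/-- `C` can be grown to all edges one at a time, each new edge touching the old ones and so raising
the excess by at least 1. Hence excess minus size never decreases. -/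
lemma excess_add_card_le [Fintype E] (hI : Connected I) (hC : C.Nonempty) :
    excess I C + Fintype.card E ≤ excess I univ + #C := by
  induction hn : Fintype.card E - #C generalizing C with
  | zero =>
    have : C = univ := by
      rw [← card_eq_iff_eq_univ]
      exact le_antisymm (card_le_univ C) (by omega)
    subst this
    simp
  | succ n ih =>
    have hne : C ≠ univ := by
      rintro rfl
      simp at hn
    obtain ⟨e, he, v, hv, hd⟩ := hI C hC hne
    have h1 := ih (C := insert e C) (insert_nonempty e C) (by rw [card_insert_of_notMem he]; omega)
    rw [excess_insert he, card_insert_of_notMem he] at h1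
    have : 0 < #{v | I v e ∧ 0 < deg I C v} := card_pos.2 ⟨v, by simp [hv, hd]⟩
    omega

/-- A bicyclic incidence structure without pendant edges. -/
structure IsCore (I : V → E → Prop) (C : Finset E) : Prop where
  excess_eq : excess I C = #C + 1
  two_le_branch : ∀ e ∈ C, 2 ≤ branch I C e

/-- A smallest `C` with excess at least `#C + 1` works: connectedness gives the reverse inequality,
and an edge with at most one branching vertex could be removed without losing the property. -/
lemma exists_isCore [Fintype E] (hI : Connected I) (h : excess I univ = Fintype.card E + 1) :
    ∃ C, IsCore I C := by
  have hex : ∃ n, ∃ C : Finset E, #C = n ∧ #C + 1 ≤ excess I C :=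
    ⟨_, univ, rfl, by rw [h, card_univ]⟩
  obtain ⟨C, hC, hle⟩ := Nat.find_spec hex
  have hne : C.Nonempty := by
    rw [nonempty_iff_ne_empty]
    rintro rfl
    simp [excess, deg] at hle
  refine ⟨C, ?_, fun e he ↦ ?_⟩
  · have := excess_add_card_le hI hne
    omega
  · by_contra! hlt
    have h1 := excess_erase (I := I) he
    have h2 := card_erase_add_one he
    exact Nat.find_min hex (m := #(C.erase e)) (by omega) ⟨_, rfl, by omega⟩

lemma sum_branch : ∑ e ∈ C, branch I C e = ∑ v with 2 ≤ deg I C v, deg I C v := by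
  refine Eq.trans (sum_congr rfl fun e _ ↦ ?_)
    (sum_card_bipartiteAbove_eq_sum_card_bipartiteBelow (s := {v | 2 ≤ deg I C v}) (t := C) I).symm
  rw [branch, bipartiteBelow, filter_filter]
  simp only [and_comm]

lemma sum_deg (C : Finset E) : ∑ v, deg I C v = ∑ e ∈ C, #{v | I v e} :=
  sum_card_bipartiteAbove_eq_sum_card_bipartiteBelow I

lemma card_add_sum_sub_two :
    #{v | 2 ≤ deg I C v} + ∑ v, (deg I C v - 2) = excess I C := by
  rw [card_filter, ← sum_add_distrib, excess]
  refine sum_congr rfl fun v _ ↦ ?_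
  split_ifs <;> omega

namespace IsCore

lemma card_add_sum (h : IsCore I C) :
    #{v | 2 ≤ deg I C v} + ∑ v, (deg I C v - 2) = #C + 1 := by
  rw [card_add_sum_sub_two, h.excess_eq]

/-- Handshake count for the incidence graph of the core without its degree-one vertices: it is
bicyclic with minimum degree 2, so its degrees exceed 2 by a total of 2. -/
lemma sum_add_sum (h : IsCore I C) :
    ∑ v, (deg I C v - 2) + ∑ e ∈ C, (branch I C e - 2) = 2 := by
  have h1 : ∑ e ∈ C, branch I C e = ∑ e ∈ C, (branch I C e - 2) + 2 * #C := by
    rw [mul_comm, ← smul_eq_mul, ← sum_const, ← sum_add_distrib]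
    exact sum_congr rfl fun e he ↦ by have := h.two_le_branch e he; omega
  have h2 : ∑ v with 2 ≤ deg I C v, deg I C v =
      ∑ v, (deg I C v - 2) + 2 * #{v | 2 ≤ deg I C v} := by
    rw [card_filter, mul_sum, sum_filter, ← sum_add_distrib]
    refine sum_congr rfl fun v _ ↦ ?_
    split_ifs <;> omega
  have h3 := sum_branch (I := I) (C := C)
  have h4 := h.card_add_sum
  omega

lemma sum_sq (h : IsCore I C) : ∑ v, (deg I C v - 1) ^ 2 =
    #C + 1 + ∑ v, (deg I C v - 2) + ∑ v, (deg I C v - 2) ^ 2 := by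
  rw [← h.excess_eq, excess, ← sum_add_distrib, ← sum_add_distrib]
  refine sum_congr rfl fun v _ ↦ ?_
  rcases le_or_gt 2 (deg I C v) with hd | hd
  · obtain ⟨d, hd⟩ := Nat.exists_eq_add_of_le hd
    rw [hd, show 2 + d - 1 = d + 1 by omega, show 2 + d - 2 = d by omega]
    ring
  · interval_cases deg I C v <;> rfl

end IsCore

/-- Each unit of `a` is worth most when all units sit on a single vertex where `c` attains `M`. Here
`c` will come from the core and `a` from the remaining edges. -/
lemma sum_add_sq_le {c a : V → ℕ} {M : ℕ} (hc : ∀ v, c v ≤ M) :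
    ∑ v, (c v + a v) ^ 2 ≤ ∑ v, c v ^ 2 + 2 * M * (∑ v, a v) + (∑ v, a v) ^ 2 := by
  have : ∑ v, a v * (2 * c v + a v) ≤ ∑ v, a v * (2 * M + ∑ v, a v) := sum_le_sum fun v _ ↦ by
    have := hc v
    have := single_le_sum (f := a) (fun _ _ ↦ Nat.zero_le _) (mem_univ v)
    gcongr
  rw [← sum_mul] at this
  calc ∑ v, (c v + a v) ^ 2 = ∑ v, c v ^ 2 + ∑ v, a v * (2 * c v + a v) := by
        rw [← sum_add_distrib]; exact sum_congr rfl fun v _ ↦ by ring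
    _ ≤ _ := by nlinarith

lemma exists_of_sum_add_sq_eq {c a : V → ℕ} {M : ℕ} (hc : ∀ v, c v ≤ M) (ha : 0 < ∑ v, a v)
    (h : ∑ v, c v ^ 2 + 2 * M * (∑ v, a v) + (∑ v, a v) ^ 2 ≤ ∑ v, (c v + a v) ^ 2) :
    ∃ w, c w = M ∧ ∀ v ≠ w, a v = 0 := by
  have hle : ∀ v ∈ univ, a v * (2 * c v + a v) ≤ a v * (2 * M + ∑ v, a v) := fun v _ ↦ by
    have := hc v
    have := single_le_sum (f := a) (fun _ _ ↦ Nat.zero_le _) (mem_univ v)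
    gcongr
  have h1 : ∑ v, (c v + a v) ^ 2 = ∑ v, c v ^ 2 + ∑ v, a v * (2 * c v + a v) := by
    rw [← sum_add_distrib]; exact sum_congr rfl fun v _ ↦ by ring
  -- Equality of the sums forces equality termwise, so any `w` with `a w ≠ 0` has `c w = M` and
  -- carries the whole of `a`.
  have h2 : ∑ v, a v * (2 * c v + a v) = ∑ v, a v * (2 * M + ∑ v, a v) := by
    refine le_antisymm (sum_le_sum hle) ?_
    rw [← sum_mul]
    nlinarith
  rw [sum_eq_sum_iff_of_le hle] at h2
  obtain ⟨w, -, hw⟩ := exists_ne_zero_of_sum_ne_zero ha.ne'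
  have h3 := mul_left_cancel₀ hw (h2 w (mem_univ w))
  have h4 := hc w
  have h5 := single_le_sum (f := a) (fun _ _ ↦ Nat.zero_le _) (mem_univ w)
  refine ⟨w, by omega, fun v hv ↦ ?_⟩
  have h6 := add_sum_erase univ a (mem_univ w)
  have h7 := single_le_sum (s := univ.erase w) (f := a) (fun _ _ ↦ Nat.zero_le _)
    (mem_erase.2 ⟨hv, mem_univ v⟩)
  omega

end Incidence

/-! ### Non-backtracking walks in the incidence graph and girth. -/

namespace Incidence

open Finset
open scoped Classical

variable {V E : Type*} {I : V → E → Prop} {C : Finset E} {g : ℕ}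

/-- The incidence structure has no hypercycle of length less than `g`. -/
def GirthGE (I : V → E → Prop) (g : ℕ) : Prop :=
  ∀ (l : ℕ) (v : ℕ → V) (e : ℕ → E), 2 ≤ l → Set.InjOn v (Set.Iio l) → Set.InjOn e (Set.Iio l) →
    (∀ i < l, I (v i) (e i) ∧ I (v ((i + 1) % l)) (e i)) → g ≤ l

/-- Adjacency in the incidence graph of the edges in `C`, restricted to the vertices of degree at
least two. -/
def NodeAdj (I : V → E → Prop) (C : Finset E) : V ⊕ E → V ⊕ E → Prop
  | .inl v, .inr e => e ∈ C ∧ I v e ∧ 2 ≤ deg I C v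
  | .inr e, .inl v => e ∈ C ∧ I v e ∧ 2 ≤ deg I C v
  | _, _ => False

lemma NodeAdj.symm {x y : V ⊕ E} (h : NodeAdj I C x y) : NodeAdj I C y x := by
  cases x <;> cases y <;> exact h

lemma NodeAdj.isLeft {x y : V ⊕ E} (h : NodeAdj I C x y) : y.isLeft = !x.isLeft := by
  cases x <;> cases y <;> first | rfl | exact h.elim

/-- An infinite walk in the incidence graph that never turns back. -/
structure IsTrail (I : V → E → Prop) (C : Finset E) (y : ℕ → V ⊕ E) : Prop where
  adj : ∀ i, NodeAdj I C (y i) (y (i + 1))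
  ne : ∀ i, y i ≠ y (i + 2)

lemma IsTrail.isLeft {y : ℕ → V ⊕ E} (hy : IsTrail I C y) (i n : ℕ) :
    (y (i + n)).isLeft = ((y i).isLeft ^^ decide (n % 2 = 1)) := by
  induction n with
  | zero => simp
  | succ n ih =>
    rw [← add_assoc, (hy.adj _).isLeft, ih]
    rcases Nat.mod_two_eq_zero_or_one n with h | h <;>
      simp [h, Nat.add_mod]

/-- A shortest return of a trail to a node already visited closes up to a hypercycle: its nodes are
distinct by minimality and alternate between vertices and edges, so its length is half the return
time. -/
lemma GirthGE.le_of_isTrail (hg : GirthGE I g) {y : ℕ → V ⊕ E} (hy : IsTrail I C y) {i d : ℕ}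
    (hd : 0 < d) (h : y i = y (i + d)) : 2 * g ≤ d := by
  have hex : ∃ d, 0 < d ∧ ∃ i, y i = y (i + d) := ⟨d, hd, i, h⟩
  refine le_trans ?_ (Nat.find_min' hex ⟨hd, i, h⟩)
  obtain ⟨hd, i, h⟩ := Nat.find_spec hex
  have hmin := fun m ↦ Nat.find_min hex (m := m)
  generalize Nat.find hex = d at *
  have heven : d % 2 = 0 := by
    have := hy.isLeft i d
    rw [← h] at this
    rcases Nat.mod_two_eq_zero_or_one d with hm | hm
    · exact hm
    · cases hi : (y i).isLeft <;> simp [hm, hi] at this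
  obtain ⟨l, rfl⟩ : ∃ l, d = 2 * l := ⟨d / 2, by omega⟩
  have hl1 : l ≠ 1 := by
    rintro rfl
    exact hy.ne i h
  have hinj : ∀ a b, a < b → b < a + 2 * l → y a ≠ y b := fun a b hab hb he ↦
    hmin (b - a) (by omega) ⟨by omega, a, by rw [he]; congr 1; omega⟩
  -- The hypercycle must start at a vertex; if the repeated node is an edge, the starting point is
  -- shifted by one.
  obtain ⟨p, hp, hadj⟩ : ∃ p, (y p).isLeft ∧ NodeAdj I C (y p) (y (p + 2 * l - 1)) := by
    cases hi : (y i).isLeft with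
    | true =>
      refine ⟨i, hi, ?_⟩
      have := hy.adj (i + 2 * l - 1)
      rw [show i + 2 * l - 1 + 1 = i + 2 * l by omega, ← h] at this
      exact this.symm
    | false =>
      refine ⟨i + 1, by rw [(hy.adj i).isLeft, hi]; rfl, ?_⟩
      rw [show i + 1 + 2 * l - 1 = i + 2 * l by omega, ← h]
      exact (hy.adj i).symm
  have hv : ∀ s, ∃ v, y (p + 2 * s) = .inl v := fun s ↦ by
    rw [← Sum.isLeft_iff, hy.isLeft, hp]; simp
  have he : ∀ s, ∃ e, y (p + (2 * s + 1)) = .inr e := fun s ↦ by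
    rw [← Sum.isRight_iff, ← Sum.not_isLeft, hy.isLeft, hp]; simp [Nat.add_mod]
  choose v hv using hv
  choose e he using he
  suffices g ≤ l by omega
  refine hg l v e (by omega) ?_ ?_ ?_
  · intro a ha b hb hab
    simp only [Set.mem_Iio] at ha hb
    have hab' : y (p + 2 * a) = y (p + 2 * b) := by rw [hv, hv, hab]
    by_contra hne
    rcases lt_or_gt_of_ne hne with h | h
    · exact hinj _ _ (by omega) (by omega) hab'
    · exact hinj _ _ (by omega) (by omega) hab'.symm
  · intro a ha b hb hab
    simp only [Set.mem_Iio] at ha hb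
    have hab' : y (p + (2 * a + 1)) = y (p + (2 * b + 1)) := by rw [he, he, hab]
    by_contra hne
    rcases lt_or_gt_of_ne hne with h | h
    · exact hinj _ _ (by omega) (by omega) hab'
    · exact hinj _ _ (by omega) (by omega) hab'.symm
  · intro s hs
    have h1 := hy.adj (p + 2 * s)
    have h2 := hy.adj (p + (2 * s + 1))
    rw [add_assoc, hv, he] at h1
    refine ⟨h1.2.1, ?_⟩
    rcases Nat.lt_or_ge (s + 1) l with hs' | hs'
    · rw [Nat.mod_eq_of_lt hs']
      rw [he, show p + (2 * s + 1) + 1 = p + 2 * (s + 1) by ring, hv] at h2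
      exact h2.2.1
    · obtain rfl : l = s + 1 := by omega
      have h0 := hv 0
      rw [mul_zero, add_zero] at h0
      rw [h0, show p + 2 * (s + 1) - 1 = p + (2 * s + 1) by omega, he] at hadj
      rw [Nat.mod_self]
      exact hadj.2.1

/-- Trails with given first steps exist if no node has exactly one neighbour. -/
lemma exists_isTrail (hC : ∀ x y, NodeAdj I C x y → ∃ z, NodeAdj I C y z ∧ x ≠ z) {r x : V ⊕ E}
    (h : NodeAdj I C r x) : ∃ y, IsTrail I C y ∧ y 0 = r ∧ y 1 = x := by
  choose! nxt hadj hne using hC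
  let f : ℕ → {p : (V ⊕ E) × (V ⊕ E) // NodeAdj I C p.1 p.2} := fun n ↦
    Nat.rec ⟨(r, x), h⟩ (fun _ p ↦ ⟨(p.1.2, nxt p.1.1 p.1.2), hadj _ _ p.2⟩) n
  exact ⟨fun n ↦ (f n).1.1, ⟨fun n ↦ (f n).2, fun n ↦ hne _ _ (f n).2⟩, rfl, rfl⟩

/-- Running `y` backwards from step `i` to the common start and then following `z` is again a trail,
since the first steps differ. A common node would make it return after `i + j < 2 * g` steps. -/
lemma IsTrail.eq_of_eq (hg : GirthGE I g) {y z : ℕ → V ⊕ E} (hy : IsTrail I C y)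
    (hz : IsTrail I C z) (h0 : y 0 = z 0) (h1 : y 1 ≠ z 1) {i j : ℕ} (hij : i + j < 2 * g)
    (h : y i = z j) : i = 0 ∧ j = 0 := by
  by_contra hne
  have hx : IsTrail I C fun s ↦ if s ≤ i then y (i - s) else z (s - i) := by
    refine ⟨fun s ↦ ?_, fun s ↦ ?_⟩
    · rcases lt_trichotomy s i with hs | rfl | hs
      · rw [if_pos hs.le, if_pos (by omega)]
        have := hy.adj (i - (s + 1))
        rw [show i - (s + 1) + 1 = i - s by omega] at this
        exact this.symm
      · rw [if_pos le_rfl, if_neg (by omega), Nat.sub_self, h0, Nat.add_sub_cancel_left]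
        exact hz.adj 0
      · rw [if_neg (by omega), if_neg (by omega), show s + 1 - i = s - i + 1 by omega]
        exact hz.adj _
    · rcases lt_trichotomy (s + 1) i with hs | hs | hs
      · rw [if_pos (by omega), if_pos (by omega)]
        have := hy.ne (i - (s + 2))
        rw [show i - (s + 2) + 2 = i - s by omega] at this
        exact this.symm
      · rw [if_pos (by omega), if_neg (by omega), show i - s = 1 by omega,
          show s + 2 - i = 1 by omega]
        exact h1
      · rcases Nat.eq_or_lt_of_le (Nat.le_of_lt_succ hs) with rfl | hs
        · rw [if_pos le_rfl, if_neg (by omega), Nat.sub_self, h0, Nat.add_sub_cancel_left]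
          exact hz.ne 0
        · rw [if_neg (by omega), if_neg (by omega), show s + 2 - i = s - i + 2 by omega]
          exact hz.ne _
  have := hg.le_of_isTrail hx (i := 0) (d := i + j) (by omega) (by
    rw [if_pos (Nat.zero_le i), Nat.sub_zero, zero_add, h]
    split_ifs with hj
    · obtain rfl : j = 0 := by omega
      simp [h0]
    · rw [Nat.add_sub_cancel_left])
  omega

/-- Trails leaving `r` in `d` different directions. -/
structure IsStar (I : V → E → Prop) (C : Finset E) (r : V ⊕ E) (d : ℕ) (w : ℕ → ℕ → V ⊕ E) :
    Prop where
  isTrail : ∀ a < d, IsTrail I C (w a)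
  zero : ∀ a < d, w a 0 = r
  injOn : Set.InjOn (fun a ↦ w a 1) (Set.Iio d)

lemma exists_isStar (hC : ∀ x y, NodeAdj I C x y → ∃ z, NodeAdj I C y z ∧ x ≠ z) {r : V ⊕ E}
    {d : ℕ} {x : ℕ → V ⊕ E} (hx : Set.InjOn x (Set.Iio d)) (h : ∀ a < d, NodeAdj I C r (x a)) :
    ∃ w, IsStar I C r d w := by
  have : Nonempty (V ⊕ E) := ⟨r⟩
  choose! w hw h0 h1 using fun a (ha : a < d) ↦ exists_isTrail hC (h a ha)
  exact ⟨w, hw, h0, fun a ha b hb hab ↦ hx ha hb (by simpa [h1 a ha, h1 b hb] using hab)⟩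

namespace IsStar

variable {r : V ⊕ E} {d : ℕ} {w : ℕ → ℕ → V ⊕ E}

/-- The disjointness behind all counting below: within the girth range a star is an embedded tree.
-/
lemma eq_of_eq (hw : IsStar I C r d w) (hg : GirthGE I g) {a b i j : ℕ} (ha : a < d) (hb : b < d)
    (hij : i + j < 2 * g) (h : w a i = w b j) : i = j ∧ (i = 0 ∨ a = b) := by
  by_cases hab : a = b
  · subst hab
    refine ⟨?_, .inr rfl⟩
    by_contra hne
    rcases lt_or_gt_of_ne hne with hlt | hlt
    · have := hg.le_of_isTrail (hw.isTrail a ha) (i := i) (d := j - i) (by omega)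
        (by rw [h]; congr 1; omega)
      omega
    · have := hg.le_of_isTrail (hw.isTrail a ha) (i := j) (d := i - j) (by omega)
        (by rw [← h]; congr 1; omega)
      omega
  · have := IsTrail.eq_of_eq hg (hw.isTrail a ha) (hw.isTrail b hb)
      ((hw.zero a ha).trans (hw.zero b hb).symm) (fun h1 ↦ hab (hw.injOn ha hb h1)) hij h
    omega

lemma isLeft (hw : IsStar I C r d w) {a : ℕ} (ha : a < d) (i : ℕ) :
    (w a i).isLeft = (r.isLeft ^^ decide (i % 2 = 1)) := by
  have := (hw.isTrail a ha).isLeft 0 i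
  rwa [zero_add, hw.zero a ha] at this

end IsStar

/-- Minimum degree 2: a kept vertex lies on two core edges, and a core edge has two branching
vertices. Hence a walk can always continue without turning back. -/
lemma IsCore.exists_nodeAdj [Fintype V] (h : IsCore I C) (x y : V ⊕ E) (hxy : NodeAdj I C x y) :
    ∃ z, NodeAdj I C y z ∧ x ≠ z := by
  match x, y with
  | .inl v, .inr e =>
    obtain ⟨u, hu, huv⟩ := exists_mem_ne (h.two_le_branch e hxy.1) v
    simp only [mem_filter, mem_univ, true_and] at hu
    exact ⟨.inl u, ⟨hxy.1, hu.1, hu.2⟩, by simpa using huv.symm⟩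
  | .inr e, .inl v =>
    obtain ⟨f, hf, hfe⟩ := exists_mem_ne hxy.2.2 e
    simp only [mem_filter] at hf
    exact ⟨.inr f, ⟨hf.1, hf.2, hxy.2.2⟩, by simpa using hfe.symm⟩
  | .inl _, .inl _ | .inr _, .inr _ => exact hxy.elim

lemma exists_injOn_of_le_card {β : Type*} [Nonempty β] {s : Finset β} {n : ℕ} (h : n ≤ #s) :
    ∃ f : ℕ → β, Set.InjOn f (Set.Iio n) ∧ ∀ i < n, f i ∈ s := by
  have hlt : ∀ i < n, i < #s := fun i hi ↦ hi.trans_le h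
  refine ⟨fun i ↦ if hi : i < #s then s.equivFin.symm ⟨i, hi⟩ else Classical.arbitrary β, ?_, ?_⟩
  · intro i hi j hj hij
    simp only [dif_pos (hlt i hi), dif_pos (hlt j hj)] at hij
    simpa using Subtype.ext hij
  · intro i hi
    simp [dif_pos (hlt i hi)]

lemma IsCore.exists_isStar_inl [Fintype V] (h : IsCore I C) {u : V} {d : ℕ} (hd : d ≤ deg I C u)
    (h2 : 2 ≤ d) : ∃ w, IsStar I C (.inl u) d w := by
  have : Nonempty E := (card_pos.1 (by unfold deg at hd; omega : 0 < #{e ∈ C | I u e})).to_type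
  obtain ⟨f, hf, hfC⟩ := exists_injOn_of_le_card hd
  refine exists_isStar h.exists_nodeAdj (x := fun a ↦ .inr (f a))
    (fun a ha b hb hab ↦ hf ha hb (by simpa using hab)) fun a ha ↦ ?_
  have := hfC a ha
  simp only [mem_filter] at this
  exact ⟨this.1, this.2, h2.trans hd⟩

lemma IsCore.exists_isStar_inr [Fintype V] (h : IsCore I C) {e : E} (he : e ∈ C) {d : ℕ}
    (hd : d ≤ branch I C e) : ∃ w, IsStar I C (.inr e) d w := by
  have : Nonempty V := (card_pos.1 (lt_of_lt_of_le two_pos (h.two_le_branch e he))).to_type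
  obtain ⟨f, hf, hfC⟩ := exists_injOn_of_le_card hd
  refine exists_isStar h.exists_nodeAdj (x := fun a ↦ .inl (f a))
    (fun a ha b hb hab ↦ hf ha hb (by simpa using hab)) fun a ha ↦ ?_
  have := hfC a ha
  simp only [mem_filter, mem_univ, true_and] at this
  exact ⟨he, this.1, this.2⟩

end Incidence

/-! ### Lower bounds for the size of the core, and the bound on the sum of squares. -/

namespace Incidence

open Finset
open scoped Classical

variable {V E : Type*} {I : V → E → Prop} {C : Finset E} {g : ℕ}

namespace IsStar

variable {r : V ⊕ E} {d : ℕ} {w : ℕ → ℕ → V ⊕ E}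

lemma exists_inr (hw : IsStar I C r d w) {a i : ℕ} (ha : a < d)
    (h : r.isLeft = decide (i % 2 = 1)) : ∃ e ∈ C, w a i = .inr e := by
  have h1 := hw.isLeft ha i
  have h2 := (hw.isTrail a ha).adj i
  rw [h, Bool.xor_self, Sum.isLeft_eq_false, Sum.isRight_iff] at h1
  obtain ⟨e, he⟩ := h1
  refine ⟨e, ?_, he⟩
  rw [he] at h2
  cases hy : w a (i + 1) with
  | inl v => rw [hy] at h2; exact h2.1
  | inr f => rw [hy] at h2; exact h2.elim

lemma exists_inl (hw : IsStar I C r d w) {a i : ℕ} (ha : a < d)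
    (h : r.isLeft ≠ decide (i % 2 = 1)) : ∃ v, 2 ≤ deg I C v ∧ w a i = .inl v := by
  have h1 := hw.isLeft ha i
  have h2 := (hw.isTrail a ha).adj i
  rw [← Bool.xor_iff_ne] at h
  rw [h, Sum.isLeft_iff] at h1
  obtain ⟨v, hv⟩ := h1
  refine ⟨v, ?_, hv⟩
  rw [hv] at h2
  cases hy : w a (i + 1) with
  | inr f => rw [hy] at h2; exact h2.2.2
  | inl v => rw [hy] at h2; exact h2.elim

/-- Collects the edges at positions `2 * s + c` of all `d` trails. The offset `c` is 1 for a star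
centred at a vertex and 2 for one centred at an edge, so that these positions are edges and avoid
the centre. -/
lemma exists_subset_card_eq (hw : IsStar I C r d w) (hg : GirthGE I g) {n c : ℕ} (hc : 0 < c)
    (hn : ∀ s < n, 2 * s + c < g) (h : r.isLeft = decide (c % 2 = 1)) :
    ∃ A ⊆ C, #A = d * n ∧ ∀ e ∈ A, ∃ a < d, ∃ i, 0 < i ∧ i < g ∧ w a i = .inr e := by
  have hex : ∀ p ∈ range d ×ˢ range n, ∃ e ∈ C, w p.1 (2 * p.2 + c) = .inr e := by
    rintro ⟨a, s⟩ hp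
    simp only [mem_product, mem_range] at hp
    exact hw.exists_inr hp.1 (by simpa [Nat.add_mod] using h)
  rcases (range d ×ˢ range n).eq_empty_or_nonempty with h0 | ⟨p, hp⟩
  · have : d * n = 0 := by simpa using congrArg card h0
    exact ⟨∅, empty_subset C, by simp [this], by simp⟩
  have : Nonempty E := let ⟨e, _⟩ := hex p hp; ⟨e⟩
  choose! f hfC hf using hex
  refine ⟨(range d ×ˢ range n).image f, image_subset_iff.2 hfC, ?_, ?_⟩
  · rw [card_image_of_injOn, card_product, card_range, card_range]
    rintro ⟨a, s⟩ hp ⟨b, t⟩ hq hpq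
    have h1 := hf _ hp
    rw [hpq, ← hf _ hq] at h1
    simp only [coe_product, coe_range, Set.mem_prod, Set.mem_Iio] at hp hq
    have hs := hn s hp.2
    have ht := hn t hq.2
    have := hw.eq_of_eq hg hp.1 hq.1 (by omega) h1
    ext <;> simp <;> omega
  · intro e he
    obtain ⟨⟨a, s⟩, hp, rfl⟩ := mem_image.1 he
    have h1 := hf _ hp
    simp only [mem_product, mem_range] at hp
    exact ⟨a, hp.1, 2 * s + c, by omega, hn s hp.2, h1⟩

lemma mul_le_card {u : V} (hw : IsStar I C (.inl u) d w) (hg : GirthGE I g) :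
    d * (g / 2) ≤ #C := by
  obtain ⟨A, hA, hcard, -⟩ := hw.exists_subset_card_eq hg (n := g / 2) (c := 1) one_pos
    (fun s hs ↦ by omega) (by simp)
  exact hcard ▸ card_le_card hA

/-- If three trails meet in an edge at step `g`, their predecessors at step `g - 1` are still
distinct, and all lie on that edge. -/
lemma three_le_branch [Fintype V] {u : V} (hw : IsStar I C (.inl u) d w) (hg : GirthGE I g)
    (h3 : 3 ≤ d) (hodd : g % 2 = 1) {e : E} (he : ∀ a < 3, w a g = .inr e) : 3 ≤ branch I C e := by
  have hex : ∀ a < 3, ∃ v, w a (g - 1) = .inl v ∧ I v e ∧ 2 ≤ deg I C v := fun a ha ↦ by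
    obtain ⟨v, hv, hwv⟩ := hw.exists_inl (a := a) (i := g - 1) (by omega)
      (by simp; omega)
    have := (hw.isTrail a (by omega)).adj (g - 1)
    rw [hwv, show g - 1 + 1 = g by omega, he a ha] at this
    exact ⟨v, hwv, this.2⟩
  have : Nonempty V := ⟨u⟩
  choose! v hwv hv using hex
  have hinj : Set.InjOn v (Set.Iio 3) := fun a ha b hb hab ↦ by
    simp only [Set.mem_Iio] at ha hb
    have h1 := hwv a ha
    rw [hab, ← hwv b hb] at h1
    have h2 := hw.eq_of_eq hg (by omega) (by omega) (by omega) h1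
    rcases h2.2 with h0 | h2
    -- For `g = 1` the predecessors all coincide with the centre, but then distinct first steps
    -- already contradict the meeting.
    · have : g = 1 := by omega
      have ha0 := he a ha
      have hb0 := he b hb
      rw [this] at ha0 hb0
      exact hw.injOn (ha.trans_le h3) (hb.trans_le h3) (ha0.trans hb0.symm)
    · exact h2
  calc 3 = #((range 3).image v) := by rw [card_image_of_injOn (by simpa using hinj), card_range]
    _ ≤ branch I C e := card_le_card fun x hx ↦ by
      obtain ⟨a, ha, rfl⟩ := mem_image.1 hx
      simpa using hv a (mem_range.1 ha)

lemma mul_add_one_le_card {u : V} (hw : IsStar I C (.inl u) d w) (hg : GirthGE I g) (h3 : 3 ≤ d)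
    (hodd : g % 2 = 1) : d * (g / 2) + 1 ≤ #C := by
  obtain ⟨A, hA, hcard, hAw⟩ := hw.exists_subset_card_eq hg (n := g / 2) (c := 1) one_pos
    (fun s hs ↦ by omega) (by simp)
  obtain ⟨e, he, hwe⟩ := hw.exists_inr (a := 0) (i := g) (by omega) (by simp [hodd])
  have heA : e ∉ A := fun h ↦ by
    obtain ⟨a, ha, i, hi, hig, hai⟩ := hAw e h
    have := hw.eq_of_eq hg (by omega) ha (by omega) (hwe.trans hai.symm)
    omega
  rw [← hcard, ← card_insert_of_notMem heA]
  exact card_le_card (insert_subset he hA)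

/-- The edges reached at step `g` are new, and without an edge of branch 3 three trails cannot all
reach the same one; this yields two further edges. -/
lemma mul_add_two_le_card [Fintype V] {u : V} (hw : IsStar I C (.inl u) d w) (hg : GirthGE I g)
    (h3 : 3 ≤ d) (hodd : g % 2 = 1) (hb : ∀ e ∈ C, branch I C e ≤ 2) :
    d * (g / 2) + 2 ≤ #C := by
  obtain ⟨A, hA, hcard, hAw⟩ := hw.exists_subset_card_eq hg (n := g / 2) (c := 1) one_pos
    (fun s hs ↦ by omega) (by simp)
  have hex : ∀ a < 3, ∃ e ∈ C, w a g = .inr e ∧ e ∉ A := fun a ha ↦ by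
    obtain ⟨e, he, hwe⟩ := hw.exists_inr (a := a) (i := g) (by omega) (by simp [hodd])
    refine ⟨e, he, hwe, fun h ↦ ?_⟩
    obtain ⟨b, hb, i, hi, hig, hbi⟩ := hAw e h
    have := hw.eq_of_eq hg (by omega) hb (by omega) (hwe.trans hbi.symm)
    omega
  obtain ⟨e, he, hwe, heA⟩ := hex 0 (by omega)
  obtain ⟨a, ha, f, hf, hwf, hfA, hne⟩ :
      ∃ a < 3, ∃ f ∈ C, w a g = .inr f ∧ f ∉ A ∧ f ≠ e := by
    by_contra! hall
    have := hw.three_le_branch hg h3 hodd (e := e) fun a ha ↦ by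
      obtain ⟨f, hf, hwf, hfA⟩ := hex a ha
      rw [hwf, hall a ha f hf hwf hfA]
    have := hb e he
    omega
  have := card_le_card (insert_subset hf (insert_subset he hA))
  rw [card_insert_of_notMem (by simp [hfA, hne]), card_insert_of_notMem heA] at this
  omega

/-- The two additional edges are the centre `e` and the edge at step `g` of one trail. -/
lemma mul_add_two_le_card_of_inr {e : E} (he : e ∈ C) (hw : IsStar I C (.inr e) d w)
    (hg : GirthGE I g) (h0 : 0 < d) (h2 : 2 ≤ g) (heven : g % 2 = 0) :
    d * (g / 2 - 1) + 2 ≤ #C := by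
  obtain ⟨A, hA, hcard, hAw⟩ := hw.exists_subset_card_eq hg (n := g / 2 - 1) (c := 2) two_pos
    (fun s hs ↦ by omega) (by simp)
  obtain ⟨f, hf, hwf⟩ := hw.exists_inr (a := 0) (i := g) (by omega) (by simp [heven])
  have heA : e ∉ A := fun h ↦ by
    obtain ⟨a, ha, i, hi, hig, hai⟩ := hAw e h
    have := hw.eq_of_eq hg ha ha (by omega) (hai.trans (hw.zero a ha).symm)
    omega
  have hfA : f ∉ A := fun h ↦ by
    obtain ⟨a, ha, i, hi, hig, hai⟩ := hAw f h
    have := hw.eq_of_eq hg (by omega) ha (by omega) (hwf.trans hai.symm)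
    omega
  have hfe : f ≠ e := by
    rintro rfl
    have := hw.eq_of_eq hg (by omega) (by omega) (by omega) (hwf.trans (hw.zero 0 h0).symm)
    omega
  have := card_le_card (insert_subset hf (insert_subset he hA))
  rw [card_insert_of_notMem (by simp [hfA, hfe]), card_insert_of_notMem heA] at this
  omega

lemma mul_add_one_le_card_of_inr {e : E} (he : e ∈ C) (hw : IsStar I C (.inr e) d w)
    (hg : GirthGE I g) (hodd : g % 2 = 1) : d * (g / 2) + 1 ≤ #C := by
  obtain ⟨A, hA, hcard, hAw⟩ := hw.exists_subset_card_eq hg (n := g / 2) (c := 2) two_pos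
    (fun s hs ↦ by omega) (by simp)
  have heA : e ∉ A := fun h ↦ by
    obtain ⟨a, ha, i, hi, hig, hai⟩ := hAw e h
    have := hw.eq_of_eq hg ha ha (by omega) (hai.trans (hw.zero a ha).symm)
    omega
  rw [← hcard, ← card_insert_of_notMem heA]
  exact card_le_card (insert_subset he hA)

end IsStar

lemma add_sub_deg [Fintype E] (v : V) :
    (deg I C v - 1) + ((deg I univ v - 1) - (deg I C v - 1)) = deg I univ v - 1 := by
  have := deg_mono (I := I) (subset_univ C) v
  omega

variable [Fintype V]

lemma IsCore.sum_sq_le (h : IsCore I C) {D : ℕ} (hD : ∀ v, deg I C v - 2 ≤ D) :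
    ∑ v, (deg I C v - 1) ^ 2 ≤ #C + 1 + (D + 1) * ∑ v, (deg I C v - 2) := by
  have : ∑ v, (deg I C v - 2) ^ 2 ≤ D * ∑ v, (deg I C v - 2) := by
    rw [mul_sum]
    exact sum_le_sum fun v _ ↦ by rw [sq]; exact Nat.mul_le_mul_right _ (hD v)
  rw [h.sum_sq]
  linarith

variable [Fintype E]

/-- Both the whole structure and the core have excess equal to size plus one, so the edges outside
the core contribute as much excess as there are of them. -/
lemma IsCore.sum_sub (h : IsCore I C) (hex : excess I univ = Fintype.card E + 1) :
    ∑ v, ((deg I univ v - 1) - (deg I C v - 1)) = Fintype.card E - #C := by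
  rw [sum_tsub_distrib _ fun v _ ↦ Nat.sub_le_sub_right (deg_mono (subset_univ C) v) 1]
  have := h.excess_eq
  unfold excess at this hex
  omega

lemma IsCore.sum_sq_univ_le (h : IsCore I C) (hex : excess I univ = Fintype.card E + 1) {D t : ℕ}
    (ht : Fintype.card E = #C + t) (hD : ∀ v, deg I C v - 2 ≤ D) :
    ∑ v, (deg I univ v - 1) ^ 2 ≤
      #C + 1 + (D + 1) * ∑ v, (deg I C v - 2) + 2 * (D + 1) * t + t ^ 2 := by
  have h1 := sum_add_sq_le (c := fun v ↦ deg I C v - 1)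
    (a := fun v ↦ (deg I univ v - 1) - (deg I C v - 1)) (M := D + 1) fun v ↦ by
      have := hD v
      omega
  simp only [add_sub_deg, h.sum_sub hex] at h1
  rw [ht, Nat.add_sub_cancel_left] at h1
  have := h.sum_sq_le hD
  omega

lemma IsCore.exists_of_le_sum_sq (h : IsCore I C) (hex : excess I univ = Fintype.card E + 1)
    {D t : ℕ} (ht : Fintype.card E = #C + t) (h0 : 0 < t) (hD : ∀ v, deg I C v - 2 ≤ D)
    (hle : #C + 1 + (D + 1) * ∑ v, (deg I C v - 2) + 2 * (D + 1) * t + t ^ 2 ≤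
      ∑ v, (deg I univ v - 1) ^ 2) :
    ∃ w, deg I C w = D + 2 ∧ ∀ v ≠ w, deg I univ v - 1 = deg I C v - 1 := by
  have hs : ∑ v, ((deg I univ v - 1) - (deg I C v - 1)) = t := by
    rw [h.sum_sub hex]; omega
  obtain ⟨w, hw, ha⟩ := exists_of_sum_add_sq_eq (c := fun v ↦ deg I C v - 1)
    (a := fun v ↦ (deg I univ v - 1) - (deg I C v - 1)) (M := D + 1)
    (fun v ↦ by have := hD v; omega) (by rwa [hs]) (by
      simp only [add_sub_deg, hs]
      have := h.sum_sq_le hD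
      omega)
  refine ⟨w, by omega, fun v hv ↦ ?_⟩
  have h1 := ha v hv
  have h2 := add_sub_deg (I := I) (C := C) v
  omega

/-- The conditions on the core `C` and on the vertex `w` that carries all other edges under which
the Zagreb index is maximal. -/
structure IsExtremal (I : V → E → Prop) (g : ℕ) (C : Finset E) (w : V) : Prop extends
    IsCore I C where
  card_eq : #C = 3 * g / 2
  sum_eq : ∑ v, (deg I C v - 2) + g % 2 = 2
  deg_eq : deg I C w = 3
  deg_univ_eq : ∀ v ≠ w, deg I univ v - 1 = deg I C v - 1

/-- Cases according to the vertex surplus σ of the core. In each case `s` measures how far the core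
exceeds its girth bound. A larger core leaves fewer outside edges, and the quadratic loss outweighs
the linear gain from core edges, so equality needs `s = 0` and the right branching. -/
lemma sum_sq_le_and_exists_isExtremal (hI : Connected I)
    (hex : excess I univ = Fintype.card E + 1) (hg : GirthGE I g) (h3 : 3 ≤ g)
    (hm : 2 * g ≤ Fintype.card E) :
    ∑ v, (deg I univ v - 1) ^ 2 + 2 * (g % 2) ≤
      (Fintype.card E - 3 * g / 2 + 2) ^ 2 + 3 * g / 2 + 1 ∧
    (∑ v, (deg I univ v - 1) ^ 2 + 2 * (g % 2) =
      (Fintype.card E - 3 * g / 2 + 2) ^ 2 + 3 * g / 2 + 1 → ∃ C w, IsExtremal I g C w) := by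
  obtain ⟨C, hC⟩ := exists_isCore hI hex
  obtain ⟨t, ht⟩ := Nat.exists_eq_add_of_le (card_le_univ C)
  have hsum := hC.sum_add_sum
  have hle : ∀ v, deg I C v - 2 ≤ ∑ v, (deg I C v - 2) := fun v ↦
    single_le_sum (f := fun v ↦ deg I C v - 2) (fun _ _ ↦ Nat.zero_le _) (mem_univ v)
  have hX := fun D ↦ hC.sum_sq_univ_le hex ht (D := D)
  have hXeq := fun D h0 ↦ hC.exists_of_le_sum_sq hex ht h0 (D := D)
  have hdeg : ∀ D, ∑ v, (deg I C v - 2) ≠ 0 → (∀ v, deg I C v - 2 ≤ D) → D = 1 →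
      ∃ v, 3 ≤ deg I C v := fun D h0 hD hD1 ↦ by
    obtain ⟨v, -, hv⟩ := exists_ne_zero_of_sum_ne_zero h0
    exact ⟨v, by omega⟩
  have hbr : ∑ e ∈ C, (branch I C e - 2) = 0 → ∀ e ∈ C, branch I C e ≤ 2 := fun h e he ↦ by
    have := sum_eq_zero_iff.1 h e he
    omega
  generalize hσ : ∑ v, (deg I C v - 2) = σ at *
  generalize hXd : ∑ v, (deg I univ v - 1) ^ 2 = X at *
  generalize hS : #C = S at *
  generalize Fintype.card E = m at *
  have hσ2 : σ ≤ 2 := by omega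
  obtain ⟨h, hgh⟩ : ∃ h, g = 2 * h ∨ g = 2 * h + 1 := ⟨g / 2, by omega⟩
  interval_cases σ
  -- σ = 0: all branching is at edges and every core degree is at most 2. The core may be smaller by
  -- one edge when `g` is even, but each outside edge gains less.
  · obtain ⟨e, he, hne⟩ := exists_ne_zero_of_sum_ne_zero
      (show ∑ e ∈ C, (branch I C e - 2) ≠ 0 by omega)
    obtain ⟨w, hw⟩ := hC.exists_isStar_inr he (d := 3) (by omega)
    have hX := hX 0 hle
    rcases hgh with rfl | rfl
    · have := hw.mul_add_two_le_card_of_inr he hg (by omega) (by omega) (by omega)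
      rw [hS, show 2 * h / 2 = h by omega] at this
      obtain ⟨s, hs⟩ := Nat.exists_eq_add_of_le this
      have hmt : m - 3 * (2 * h) / 2 + 2 = t + s + 1 := by omega
      have hS0 : 3 * (2 * h) / 2 = 3 * h := by omega
      rw [hmt, hS0]
      have : X < (t + s + 1) ^ 2 + 3 * h + 1 := by
        have : S + 1 = 3 * h + s := by omega
        linarith [Nat.zero_le (t * s), Nat.zero_le (s ^ 2)]
      constructor <;> omega
    · have := hw.mul_add_one_le_card_of_inr he hg (by omega)
      rw [hS, show (2 * h + 1) / 2 = h by omega] at this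
      obtain ⟨s, hs⟩ := Nat.exists_eq_add_of_le this
      have hmt : m - 3 * (2 * h + 1) / 2 + 2 = t + s + 2 := by omega
      have hS0 : 3 * (2 * h + 1) / 2 = 3 * h + 1 := by omega
      rw [hmt, hS0]
      have : X + 2 < (t + s + 2) ^ 2 + (3 * h + 1) + 1 := by
        linarith [Nat.zero_le (t * s), Nat.zero_le (s ^ 2)]
      constructor <;> omega
  -- σ = 1: one vertex of core degree 3 and one edge of branch 3. This is optimal exactly for odd
  -- `g`; for even `g` the bound is missed by 2.
  · obtain ⟨u, hu⟩ := hdeg 1 (by omega) hle rfl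
    obtain ⟨w, hw⟩ := hC.exists_isStar_inl hu (by omega)
    have hX := hX 1 hle
    rcases hgh with rfl | rfl
    · have := hw.mul_le_card hg
      rw [hS, show 2 * h / 2 = h by omega] at this
      obtain ⟨s, hs⟩ := Nat.exists_eq_add_of_le this
      have hmt : m - 3 * (2 * h) / 2 + 2 = t + s + 2 := by omega
      have hS0 : 3 * (2 * h) / 2 = 3 * h := by omega
      rw [hmt, hS0]
      have : X < (t + s + 2) ^ 2 + 3 * h + 1 := by
        linarith [Nat.zero_le (t * s), Nat.zero_le (s ^ 2)]
      constructor <;> omega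
    · have := hw.mul_add_one_le_card hg (by omega) (by omega)
      rw [hS, show (2 * h + 1) / 2 = h by omega] at this
      obtain ⟨s, hs⟩ := Nat.exists_eq_add_of_le this
      have hmt : m - 3 * (2 * h + 1) / 2 + 2 = t + s + 2 := by omega
      have hS0 : 3 * (2 * h + 1) / 2 = 3 * h + 1 := by omega
      rw [hmt, hS0]
      have : X + 2 + 3 * s ≤ (t + s + 2) ^ 2 + (3 * h + 1) + 1 := by
        linarith [Nat.zero_le (t * s), Nat.zero_le (s ^ 2)]
      refine ⟨by omega, fun heq ↦ ?_⟩
      obtain rfl : s = 0 := by omega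
      -- There is at least one outside edge because `2 * g` exceeds `3 * g / 2`; it determines the
      -- vertex `w`.
      obtain ⟨w, hw, hdw⟩ := hXeq 1 (by omega) hle (by
        rw [show (2 * h + 1) % 2 = 1 by omega] at heq
        linarith)
      exact ⟨C, w, hC, by omega, by omega, hw, hdw⟩
  -- σ = 2: all branching is at vertices, either one of core degree 4 or two of core degree 3.
  · have hb := hbr (by omega)
    by_cases h4 : ∃ v, 4 ≤ deg I C v
    -- Core degree 4 raises the gain per outside edge, but four trails force about `g / 2` more core
    -- edges.
    · obtain ⟨u, hu⟩ := h4
      obtain ⟨w, hw⟩ := hC.exists_isStar_inl hu (by omega)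
      have hX := hX 2 hle
      rcases hgh with rfl | rfl
      · have := hw.mul_le_card hg
        rw [hS, show 2 * h / 2 = h by omega] at this
        obtain ⟨s, hs⟩ := Nat.exists_eq_add_of_le this
        have hmt : m - 3 * (2 * h) / 2 + 2 = t + s + h + 2 := by omega
        have hS0 : 3 * (2 * h) / 2 = 3 * h := by omega
        rw [hmt, hS0]
        obtain ⟨h', rfl⟩ : ∃ h', h = h' + 2 := ⟨h - 2, by omega⟩
        have : X < (t + s + (h' + 2) + 2) ^ 2 + 3 * (h' + 2) + 1 := by
          linarith [Nat.zero_le (t * s), Nat.zero_le (s ^ 2), Nat.zero_le (t * h'),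
            Nat.zero_le (s * h'), Nat.zero_le (h' ^ 2)]
        constructor <;> omega
      · have := hw.mul_add_two_le_card hg (by omega) (by omega) hb
        rw [hS, show (2 * h + 1) / 2 = h by omega] at this
        obtain ⟨s, hs⟩ := Nat.exists_eq_add_of_le this
        have hmt : m - 3 * (2 * h + 1) / 2 + 2 = t + s + h + 3 := by omega
        have hS0 : 3 * (2 * h + 1) / 2 = 3 * h + 1 := by omega
        rw [hmt, hS0]
        have : X + 2 < (t + s + h + 3) ^ 2 + (3 * h + 1) + 1 := by
          linarith [Nat.zero_le (t * s), Nat.zero_le (s ^ 2), Nat.zero_le (t * h),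
            Nat.zero_le (s * h), Nat.zero_le (h ^ 2)]
        constructor <;> omega
    · have hD : ∀ v, deg I C v - 2 ≤ 1 := fun v ↦ by
        have : ¬ 4 ≤ deg I C v := fun h ↦ h4 ⟨v, h⟩
        omega
      obtain ⟨u, hu⟩ := hdeg 1 (by omega) hD rfl
      obtain ⟨w, hw⟩ := hC.exists_isStar_inl hu (by omega)
      have hX := hX 1 hD
      rcases hgh with rfl | rfl
      -- Two vertices of core degree 3: optimal exactly for even `g`. For odd `g` the absence of an
      -- edge of branch 3 costs one more core edge.
      · have := hw.mul_le_card hg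
        rw [hS, show 2 * h / 2 = h by omega] at this
        obtain ⟨s, hs⟩ := Nat.exists_eq_add_of_le this
        have hmt : m - 3 * (2 * h) / 2 + 2 = t + s + 2 := by omega
        have hS0 : 3 * (2 * h) / 2 = 3 * h := by omega
        rw [hmt, hS0]
        have : X + 3 * s ≤ (t + s + 2) ^ 2 + 3 * h + 1 := by
          linarith [Nat.zero_le (t * s), Nat.zero_le (s ^ 2)]
        refine ⟨by omega, fun heq ↦ ?_⟩
        obtain rfl : s = 0 := by omega
        obtain ⟨w, hw, hdw⟩ := hXeq 1 (by omega) hD (by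
          rw [show 2 * h % 2 = 0 by omega] at heq
          linarith)
        exact ⟨C, w, hC, by omega, by omega, hw, hdw⟩
      · have := hw.mul_add_two_le_card hg (by omega) (by omega) hb
        rw [hS, show (2 * h + 1) / 2 = h by omega] at this
        obtain ⟨s, hs⟩ := Nat.exists_eq_add_of_le this
        have hmt : m - 3 * (2 * h + 1) / 2 + 2 = t + s + 3 := by omega
        have hS0 : 3 * (2 * h + 1) / 2 = 3 * h + 1 := by omega
        rw [hmt, hS0]
        have : X + 2 < (t + s + 3) ^ 2 + (3 * h + 1) + 1 := by
          linarith [Nat.zero_le (t * s), Nat.zero_le (s ^ 2)]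
        constructor <;> omega

end Incidence

/-! ### Theta labellings, and the structure of extremal cores. -/

/-- Labels of the vertices of degree at least two in a theta hypergraph. The incidence graph of its
core consists of three paths of length `g` from the node `(0, 0)` to the node `(0, g)`. The `i`-th
node of the `a`-th path is `(a, i)`, for `0 < i < g`; it is a vertex if `i` is even. -/
def thetaVerts (g : ℕ) : Set (ℕ × ℕ) :=
  {x | x.2 % 2 = 0 ∧ x.1 < 3 ∧ x.2 ≤ g ∧ (x.2 = 0 ∨ x.2 = g → x.1 = 0)}

/-- Labels of the edges of a theta hypergraph: the odd nodes of the three paths, and `(3 + j, 1)`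
for the `j`-th pendant edge. -/
def thetaEdges (g t : ℕ) : Set (ℕ × ℕ) :=
  {y | y.2 % 2 = 1 ∧ ((y.1 < 3 ∧ y.2 ≤ g ∧ (y.2 = g → y.1 = 0)) ∨
    (3 ≤ y.1 ∧ y.1 < 3 + t ∧ y.2 = 1))}

/-- Incidence of the vertex labelled `x` with the edge labelled `y`. -/
def ThetaInc (g : ℕ) (x y : ℕ × ℕ) : Prop :=
  (x.2 + 1 = y.2 ∨ y.2 + 1 = x.2) ∧ (x.1 = y.1 ∨ x.2 = 0 ∨ x.2 = g ∨ y.2 = g)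

namespace Incidence

open Finset
open scoped Classical

variable {V E : Type*} {I : V → E → Prop} {C : Finset E} {g : ℕ}

/-- The incidence structure is that of a theta hypergraph with vertices and edges labelled by
`γ` and `ε`. -/
structure IsTheta (I : V → E → Prop) (g t : ℕ) (γ : ℕ × ℕ → V) (ε : ℕ × ℕ → E) : Prop where
  injOn : Set.InjOn γ (thetaVerts g)
  bijOn : Set.BijOn ε (thetaEdges g t) Set.univ
  inc_iff : ∀ x ∈ thetaVerts g, ∀ y ∈ thetaEdges g t, I (γ x) (ε y) ↔ ThetaInc g x y
  mem_image : ∀ e f v, e ≠ f → I v e → I v f → v ∈ γ '' thetaVerts g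

lemma exists_bijOn_of_card_eq {β : Type*} [Nonempty β] {s : Finset β} {n : ℕ} (h : #s = n) :
    ∃ f : ℕ → β, Set.BijOn f (Set.Iio n) s := by
  obtain ⟨f, hf, hs⟩ := exists_injOn_of_le_card h.ge
  refine ⟨f, fun i hi ↦ hs i hi, hf, ?_⟩
  have : (range n).image f = s := eq_of_subset_of_card_le
    (image_subset_iff.2 fun i hi ↦ hs i (mem_range.1 hi))
    (by rw [card_image_of_injOn (by simpa using hf), card_range, h])
  rw [← this]
  simp [Set.SurjOn]

/-- The nodes of the incidence graph of `C`, without the vertices of degree one. -/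
noncomputable def coreNodes [Fintype V] (I : V → E → Prop) (C : Finset E) : Finset (V ⊕ E) :=
  disjSum {v | 2 ≤ deg I C v} C

lemma NodeAdj.mem_coreNodes [Fintype V] {x y : V ⊕ E} (h : NodeAdj I C x y) :
    x ∈ coreNodes I C := by
  cases x <;> cases y <;> first | exact h.elim | skip
  · simpa [coreNodes] using h.2.2
  · simpa [coreNodes] using h.1

namespace IsStar

variable {r : V ⊕ E} {d : ℕ} {w : ℕ → ℕ → V ⊕ E}

/-- At the two common ends the path index is immaterial, so both nodes can be taken on one trail. -/
lemma adj_of_thetaInc (hw : IsStar I C r 3 w) (hz : ∀ a < 3, w a g = w 0 g) {x y : ℕ × ℕ}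
    (hx : x.1 < 3) (hy : y.1 < 3) (h : ThetaInc g x y) :
    NodeAdj I C (w x.1 x.2) (w y.1 y.2) := by
  obtain ⟨c, hc, h1, h2⟩ : ∃ c < 3, w x.1 x.2 = w c x.2 ∧ w y.1 y.2 = w c y.2 := by
    rcases h.2 with h | h | h | h
    · exact ⟨x.1, hx, rfl, by rw [h]⟩
    · exact ⟨y.1, hy, by rw [h, hw.zero _ hx, hw.zero _ hy], rfl⟩
    · exact ⟨y.1, hy, by rw [h, hz _ hx, hz _ hy], rfl⟩
    · exact ⟨x.1, hx, rfl, by rw [h, hz _ hx, hz _ hy]⟩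
  rw [h1, h2]
  rcases h.1 with h | h
  · rw [← h]
    exact (hw.isTrail c hc).adj _
  · rw [← h]
    exact ((hw.isTrail c hc).adj _).symm

variable [Fintype V]

/-- If three trails exhaust the core, they end in the same node. -/
lemma exists_eq_joint (hw : IsStar I C r 3 w) (hg : GirthGE I g) (h0 : 0 < g)
    (hcard : #(coreNodes I C) = 3 * g - 1) :
    (∀ a < 3, w a g = w 0 g) ∧
      ∀ x ∈ coreNodes I C, ∃ a < 3, ∃ i ≤ g, (i = 0 ∨ i = g → a = 0) ∧ x = w a i := by
  set A : Finset (V ⊕ E) := insert (w 0 0) ((range 3 ×ˢ Ico 1 g).image fun p ↦ w p.1 p.2) with hA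
  have hmem : ∀ a < 3, ∀ i, w a i ∈ coreNodes I C := fun a ha i ↦
    ((hw.isTrail a ha).adj i).mem_coreNodes
  have hAsub : A ⊆ coreNodes I C := by
    refine insert_subset (hmem 0 (by omega) 0) (image_subset_iff.2 fun p hp ↦ ?_)
    simp only [mem_product, mem_range] at hp
    exact hmem _ hp.1 _
  have hAcard : #A = 3 * g - 2 := by
    rw [hA, card_insert_of_notMem, card_image_of_injOn, card_product, card_range, Nat.card_Ico]
    · omega
    · rintro ⟨a, i⟩ hp ⟨b, j⟩ hq hpq
      simp only [coe_product, coe_range, Set.mem_prod, Set.mem_Iio, coe_Ico, Set.mem_Ico] at hp hq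
      have := hw.eq_of_eq hg hp.1 hq.1 (by omega) hpq
      ext <;> simp <;> omega
    · rw [Finset.mem_image]
      rintro ⟨⟨a, i⟩, hp, hpq⟩
      simp only [mem_product, mem_range, mem_Ico] at hp
      have := hw.eq_of_eq hg hp.1 (by omega) (by omega) hpq
      omega
  -- The trails up to step `g - 1` give `1 + 3 * (g - 1)` distinct nodes, one short of the total. A
  -- node at step `g` cannot be among them, since its step and theirs add up to less than `2 * g`.
  have hone : #(coreNodes I C \ A) = 1 := by
    rw [card_sdiff_of_subset hAsub]
    omega
  obtain ⟨z, hz⟩ := card_eq_one.1 hone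
  have hgz : ∀ a < 3, w a g = z := fun a ha ↦ by
    rw [← Finset.mem_singleton, ← hz, mem_sdiff, hA]
    refine ⟨hmem a ha g, fun h ↦ ?_⟩
    rw [Finset.mem_insert, Finset.mem_image] at h
    rcases h with h | ⟨⟨b, j⟩, hp, hpq⟩
    · have := hw.eq_of_eq hg ha (by omega) (by omega) h
      omega
    · simp only [mem_product, mem_range, mem_Ico] at hp
      have := hw.eq_of_eq hg hp.1 ha (by omega) hpq
      omega
  refine ⟨fun a ha ↦ (hgz a ha).trans (hgz 0 (by omega)).symm, fun x hx ↦ ?_⟩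
  by_cases hxA : x ∈ A
  · rw [hA, Finset.mem_insert, Finset.mem_image] at hxA
    rcases hxA with rfl | ⟨⟨b, j⟩, hp, rfl⟩
    · exact ⟨0, by omega, 0, by omega, fun _ ↦ rfl, rfl⟩
    · simp only [mem_product, mem_range, mem_Ico] at hp
      exact ⟨b, hp.1, j, by omega, by omega, rfl⟩
  · have : x ∈ coreNodes I C \ A := mem_sdiff.2 ⟨hx, hxA⟩
    rw [hz, Finset.mem_singleton] at this
    exact ⟨0, by omega, g, le_rfl, fun _ ↦ rfl, this.trans (hgz 0 (by omega)).symm⟩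

end IsStar

variable [Fintype V] [Fintype E]

namespace IsExtremal

variable {u : V}

/-- With surplus σ = 2 - g % 2 there are `#C + 1 - σ` kept vertices, next to `#C = 3 * g / 2` edges.
-/
lemma card_coreNodes (h : IsExtremal I g C u) (h3 : 3 ≤ g) : #(coreNodes I C) = 3 * g - 1 := by
  have h1 := h.card_add_sum
  have h2 := h.card_eq
  have h4 := h.sum_eq
  rw [coreNodes, card_disjSum]
  omega

/-- Away from `u` the core already accounts for all excess. An outside edge avoiding `u` would have
only vertices of degree 1 and be a component by itself. -/
lemma mem_of_notMem (h : IsExtremal I g C u) (hI : Connected I) (hpos : ∀ v, 0 < deg I univ v)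
    {e : E} (he : e ∉ C) : I u e := by
  by_contra hue
  have hdeg : ∀ v, I v e → deg I univ v = 1 := fun v hv ↦ by
    have hne : v ≠ u := by rintro rfl; exact hue hv
    have h1 := h.deg_univ_eq v hne
    have h2 := hpos v
    have h3 : deg I (insert e C) v ≤ deg I univ v := deg_mono (subset_univ _) v
    rw [deg_insert he, if_pos hv] at h3
    omega
  have hC : C.Nonempty := by
    rw [nonempty_iff_ne_empty]
    intro h0
    have := h.excess_eq
    simp [h0, excess, deg] at this
  obtain ⟨f, hf, v, hvf, hv⟩ := hI {e} (singleton_nonempty e) (by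
    rintro heq
    obtain ⟨f, hf⟩ := hC
    have : f ∈ ({e} : Finset E) := heq ▸ mem_univ f
    rw [Finset.mem_singleton] at this
    exact he (this ▸ hf))
  obtain ⟨e', he', hve⟩ := deg_pos_iff.1 hv
  rw [Finset.mem_singleton] at he' hf
  subst he'
  have h1 := hdeg v hve
  have h2 : deg I (insert f {e'}) v ≤ deg I univ v := deg_mono (subset_univ _) v
  rw [deg_insert (by simpa using hf), if_pos hvf] at h2
  omega

lemma notMem_of_ne (h : IsExtremal I g C u) {v : V} (hv : v ≠ u) (hd : 2 ≤ deg I C v) {e : E}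
    (he : e ∉ C) : ¬ I v e := fun hve ↦ by
  have h1 := h.deg_univ_eq v hv
  have h2 : deg I (insert e C) v ≤ deg I univ v := deg_mono (subset_univ _) v
  rw [deg_insert he, if_pos hve] at h2
  omega

/-- The edges have total surplus g % 2. For odd `g` the edge where the trails meet absorbs all of
it. -/
lemma branch_le {w : ℕ → ℕ → V ⊕ E} (h : IsExtremal I g C u) (hg : GirthGE I g)
    (hw : IsStar I C (.inl u) 3 w) (hz : ∀ a < 3, w a g = w 0 g) {e : E} (he : e ∈ C) :
    branch I C e ≤ 2 ∨ w 0 g = .inr e ∧ branch I C e ≤ 3 := by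
  have h1 := h.sum_add_sum
  have h2 := h.sum_eq
  have hle : branch I C e - 2 ≤ ∑ e ∈ C, (branch I C e - 2) :=
    single_le_sum (f := fun e ↦ branch I C e - 2) (fun _ _ ↦ Nat.zero_le _) he
  rcases Nat.mod_two_eq_zero_or_one g with hm | hm
  · left
    omega
  · obtain ⟨f, hf, hwf⟩ := hw.exists_inr (a := 0) (i := g) (by omega) (by simp [hm])
    have h3 := hw.three_le_branch hg le_rfl hm (e := f) fun a ha ↦ (hz a ha).trans hwf
    by_cases hef : e = f
    · subst hef
      exact .inr ⟨hwf, by omega⟩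
    · left
      have h4 := add_sum_erase C (fun e ↦ branch I C e - 2) hf
      have h5 := single_le_sum (s := C.erase f) (f := fun e ↦ branch I C e - 2)
        (fun _ _ ↦ Nat.zero_le _) (mem_erase.2 ⟨hef, he⟩)
      omega

/-- The neighbours of an edge along the trails are distinct and already as many as `branch_le`
allows, so there are no incidences beyond the theta pattern. -/
lemma thetaInc_of_inc {w : ℕ → ℕ → V ⊕ E} (h : IsExtremal I g C u) (hg : GirthGE I g)
    (h3 : 3 ≤ g) (hw : IsStar I C (.inl u) 3 w) (hz : ∀ a < 3, w a g = w 0 g) {x y : ℕ × ℕ}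
    (hx : x ∈ thetaVerts g) (hy : y.2 % 2 = 1 ∧ y.1 < 3 ∧ y.2 ≤ g ∧ (y.2 = g → y.1 = 0))
    {v : V} {e : E} (hv : w x.1 x.2 = .inl v) (he : w y.1 y.2 = .inr e) (hve : I v e)
    (hd : 2 ≤ deg I C v) : ThetaInc g x y := by
  obtain ⟨b, j⟩ := x
  obtain ⟨a, i⟩ := y
  obtain ⟨hx1, hx2, hx3, hx4⟩ := hx
  obtain ⟨hy1, hy2, hy3, hy4⟩ := hy
  dsimp only at *
  have hvs : v ∈ ({v | I v e ∧ 2 ≤ deg I C v} : Finset V) := by simp [hve, hd]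
  have hinl : ∀ c < 3, ∀ s, s % 2 = 0 → (s + 1 = i ∨ i + 1 = s) → w c i = .inr e →
      ∃ x, w c s = .inl x ∧ I x e ∧ 2 ≤ deg I C x := fun c hc s hs hsi hce ↦ by
    have : NodeAdj I C (w c s) (w c i) := by
      rcases hsi with rfl | rfl
      · exact (hw.isTrail c hc).adj s
      · exact ((hw.isTrail c hc).adj i).symm
    obtain ⟨x, -, hx⟩ := hw.exists_inl hc (i := s) (by simp [hs])
    rw [hx, hce] at this
    exact ⟨x, hx, this.2⟩
  have heC : e ∈ C := by
    obtain ⟨x, hx, hxe⟩ := hinl a hy2 (i - 1) (by omega) (by omega) he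
    have := (hw.isTrail a hy2).adj (i - 1)
    rw [show i - 1 + 1 = i by omega, hx, he] at this
    exact this.1
  rcases eq_or_lt_of_le hy3 with rfl | hlt
  · have hy4 := hy4 rfl
    subst hy4
    have hex := fun c hc ↦ hinl c hc (i - 1) (by omega) (by omega) ((hz c hc).trans he)
    have : Nonempty V := ⟨u⟩
    choose! f hf hfe using hex
    have hinj : Set.InjOn f (Set.Iio 3) := fun c hc c' hc' hcc ↦ by
      simp only [Set.mem_Iio] at hc hc'
      have h1 := hf c hc
      rw [hcc, ← hf c' hc'] at h1
      have := hw.eq_of_eq hg hc hc' (by omega) h1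
      omega
    have himg : (range 3).image f = ({v | I v e ∧ 2 ≤ deg I C v} : Finset V) := by
      refine eq_of_subset_of_card_le (image_subset_iff.2 fun c hc ↦ ?_) ?_
      · simpa using hfe c (mem_range.1 hc)
      · rw [card_image_of_injOn (by simpa using hinj), card_range]
        change branch I C e ≤ 3
        have := h.branch_le hg hw hz heC
        omega
    rw [← himg, Finset.mem_image] at hvs
    obtain ⟨c, hc, rfl⟩ := hvs
    rw [mem_range] at hc
    have := hw.eq_of_eq hg hx2 hc (by omega) (hv.trans (hf c hc).symm)
    unfold ThetaInc
    dsimp only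
    omega
  · obtain ⟨p, hp, hpe⟩ := hinl a hy2 (i - 1) (by omega) (by omega) he
    obtain ⟨q, hq, hqe⟩ := hinl a hy2 (i + 1) (by omega) (by omega) he
    have hpq : p ≠ q := by
      rintro rfl
      have := hw.eq_of_eq hg hy2 hy2 (by omega) (hp.trans hq.symm)
      omega
    have himg : {p, q} = ({v | I v e ∧ 2 ≤ deg I C v} : Finset V) := by
      refine eq_of_subset_of_card_le ?_ ?_
      · rw [insert_subset_iff, singleton_subset_iff]
        simp [hpe, hqe]
      · rw [card_pair hpq]
        change branch I C e ≤ 2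
        have h1 := h.branch_le hg hw hz heC
        by_contra hne
        have := hw.eq_of_eq hg hy2 (b := 0) (by omega) (by omega)
          (he.trans (h1.resolve_left hne).1.symm)
        omega
    rw [← himg, Finset.mem_insert, Finset.mem_singleton] at hvs
    unfold ThetaInc
    dsimp only
    rcases hvs with rfl | rfl
    · have := hw.eq_of_eq hg hx2 hy2 (by omega) (hv.trans hp.symm)
      omega
    · by_cases hj : j = g ∧ i + 1 = g
      · omega
      · have := hw.eq_of_eq hg hx2 hy2 (by omega) (hv.trans hq.symm)
        omega

/-- Core labels are read off from the three trails; the labels `(3 + j, 1)` enumerate the edges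
outside the core, all of which hang at `u`, labelled `(0, 0)`. -/
lemma exists_isTheta (h : IsExtremal I g C u) (hg : GirthGE I g) (h3 : 3 ≤ g) (hI : Connected I)
    (hpos : ∀ v, 0 < deg I univ v) :
    ∃ γ ε, IsTheta I g (Fintype.card E - 3 * g / 2) γ ε := by
  obtain ⟨w, hw⟩ := h.exists_isStar_inl h.deg_eq.ge (by omega)
  obtain ⟨hz, hsurj⟩ := hw.exists_eq_joint hg (by omega) (h.card_coreNodes h3)
  set t := Fintype.card E - 3 * g / 2 with ht
  have hcard : #(univ \ C) = t := by
    rw [card_sdiff_of_subset (subset_univ C), card_univ, h.card_eq]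
  have : Nonempty V := ⟨u⟩
  have hexV : ∀ x ∈ thetaVerts g, ∃ v, 2 ≤ deg I C v ∧ w x.1 x.2 = .inl v := fun x hx ↦
    hw.exists_inl hx.2.1 (by simp [hx.1])
  have hexE : ∀ y : ℕ × ℕ, y.2 % 2 = 1 → y.1 < 3 → ∃ e ∈ C, w y.1 y.2 = .inr e := fun y h2 h1 ↦
    hw.exists_inr h1 (by simp [h2])
  have : Nonempty E := let ⟨e, _⟩ := hexE (0, 1) rfl (by omega); ⟨e⟩
  choose! γ hγd hγ using hexV
  choose! f hfC hf using hexE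
  obtain ⟨p, hp⟩ := exists_bijOn_of_card_eq hcard
  have hpC : ∀ j < t, p j ∉ C := fun j hj ↦ by simpa using hp.mapsTo hj
  have h0 : ((0, 0) : ℕ × ℕ) ∈ thetaVerts g := ⟨rfl, by simp, by simp, fun _ ↦ rfl⟩
  have hγ0 : γ (0, 0) = u := by
    have := hγ _ h0
    rw [hw.zero 0 (by omega)] at this
    exact (Sum.inl_injective this).symm
  have hγinj : Set.InjOn γ (thetaVerts g) := fun x hx x' hx' hxx ↦ by
    have h1 := hγ x hx
    rw [hxx, ← hγ x' hx'] at h1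
    obtain ⟨a, i⟩ := x
    obtain ⟨b, j⟩ := x'
    obtain ⟨hx1, hx2, hx3, hx4⟩ := hx
    obtain ⟨hy1, hy2, hy3, hy4⟩ := hx'
    dsimp only at *
    by_cases hij : i = g ∧ j = g
    · ext <;> dsimp only <;> omega
    · have := hw.eq_of_eq hg hx2 hy2 (by omega) h1
      ext <;> dsimp only <;> omega
  refine ⟨γ, fun y ↦ if y.1 < 3 then f y else p (y.1 - 3), hγinj, ⟨fun _ _ ↦ Set.mem_univ _, ?_, ?_⟩,
    ?_, ?_⟩
  · rintro ⟨a, i⟩ hx ⟨b, j⟩ hy hxy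
    obtain ⟨hx1, hx2⟩ := hx
    obtain ⟨hy1, hy2⟩ := hy
    dsimp only at *
    by_cases ha : a < 3 <;> by_cases hb : b < 3
    · rw [if_pos ha, if_pos hb] at hxy
      have h1 := hf (a, i) hx1 ha
      rw [hxy, ← hf (b, j) hy1 hb] at h1
      by_cases hij : i = g ∧ j = g
      · ext <;> dsimp only <;> omega
      · have := hw.eq_of_eq hg ha hb (by dsimp only; omega) h1
        dsimp only at this
        ext <;> dsimp only <;> omega
    · rw [if_pos ha, if_neg hb] at hxy
      exact (hpC (b - 3) (by omega) (hxy ▸ hfC (a, i) hx1 ha)).elim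
    · rw [if_neg ha, if_pos hb] at hxy
      exact (hpC (a - 3) (by omega) (hxy ▸ hfC (b, j) hy1 hb)).elim
    · rw [if_neg ha, if_neg hb] at hxy
      have := hp.injOn (show a - 3 < t by omega) (show b - 3 < t by omega) hxy
      ext <;> dsimp only <;> omega
  · intro e _
    by_cases he : e ∈ C
    · obtain ⟨a, ha, i, hi, hai, hwi⟩ := hsurj (.inr e) (by simp [coreNodes, he])
      have hi2 : i % 2 = 1 := by
        have := hw.isLeft ha i
        rw [← hwi] at this
        simpa using this
      refine ⟨(a, i), ⟨hi2, .inl ⟨ha, hi, by tauto⟩⟩, ?_⟩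
      simp only [if_pos ha]
      have := hf (a, i) hi2 ha
      rw [← hwi] at this
      exact (Sum.inr_injective this).symm
    · obtain ⟨j, hj, rfl⟩ := hp.surjOn (show e ∈ ((univ \ C : Finset E) : Set E) by simpa using he)
      simp only [Set.mem_Iio] at hj
      exact ⟨(3 + j, 1), ⟨rfl, .inr ⟨by simp, by simpa using hj, rfl⟩⟩, by simp⟩
  · intro x hx y hy
    split_ifs with hy3
    · have hfy := hf y hy.1 hy3
      refine ⟨fun hinc ↦ h.thetaInc_of_inc hg h3 hw hz hx ⟨hy.1, hy3, ?_⟩ (hγ x hx) hfy hinc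
        (hγd x hx), fun hinc ↦ ?_⟩
      · rcases hy.2 with h1 | h1
        · exact h1.2
        · omega
      · have := hw.adj_of_thetaInc hz hx.2.1 hy3 hinc
        rw [hγ x hx, hfy] at this
        exact this.2.1
    · obtain ⟨hy1, hy2⟩ := hy
      have hpy := hpC (y.1 - 3) (by omega)
      by_cases hxu : γ x = u
      · obtain rfl : x = (0, 0) := hγinj hx h0 (hxu.trans hγ0.symm)
        rw [hxu]
        refine iff_of_true (h.mem_of_notMem hI hpos hpy) ⟨.inl ?_, .inr (.inl rfl)⟩
        dsimp only
        omega
      · refine iff_of_false (h.notMem_of_ne hxu (hγd x hx) hpy) fun hinc ↦ hxu ?_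
        obtain ⟨hx1, hx2, hx3, hx4⟩ := hx
        unfold ThetaInc at hinc
        have : x = (0, 0) := by ext <;> dsimp only <;> omega
        rw [this, hγ0]
  · intro e e' v hne he he'
    by_cases hvu : v = u
    · exact ⟨(0, 0), h0, hγ0.trans hvu.symm⟩
    have hd : 2 ≤ deg I univ v := by
      unfold deg
      rw [← card_pair hne]
      exact card_le_card (by simp [insert_subset_iff, he, he'])
    have := h.deg_univ_eq v hvu
    obtain ⟨a, ha, i, hi, hai, hwi⟩ := hsurj (.inl v) (by
      simp only [coreNodes, inl_mem_disjSum, mem_filter, mem_univ, true_and]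
      omega)
    have hi2 : i % 2 = 0 := by
      have := hw.isLeft ha i
      rw [← hwi] at this
      simpa using this
    have hx : (a, i) ∈ thetaVerts g := ⟨hi2, ha, hi, hai⟩
    refine ⟨(a, i), hx, ?_⟩
    have := hγ _ hx
    rw [← hwi] at this
    exact (Sum.inl_injective this).symm

end IsExtremal

end Incidence

/-! ### From hypergraphs to incidence structures. -/

namespace Hypergraph

section Incidence

open Finset
open scoped Classical

variable {α : Type*}

/-- The incidence relation between the vertices and the edges of a hypergraph. -/
def Inc (H : Hypergraph α) (v : V(H)) (e : E(H)) : Prop := (v : α) ∈ (e : Set α)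

variable {H : Hypergraph α} {k n m g : ℕ}

lemma deg_inc [Fintype E(H)] (v : V(H)) : Incidence.deg H.Inc univ v = H.degree v := by
  have : {e | e ∈ E(H) ∧ (v : α) ∈ e} =
      ((univ.filter fun e : E(H) ↦ H.Inc v e).map (Function.Embedding.subtype _) : Set (Set α)) := by
    ext e
    simp only [coe_map, Set.mem_image, mem_coe, mem_filter, mem_univ, true_and,
      Function.Embedding.subtype_apply, Set.mem_ofPred_eq]
    constructor
    · rintro ⟨he, hv⟩
      exact ⟨⟨e, he⟩, hv, rfl⟩
    · rintro ⟨e, hv, rfl⟩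
      exact ⟨e.2, hv⟩
  rw [degree, this, Set.ncard_coe_finset, card_map, Incidence.deg]

lemma zagreb_eq_sum [Fintype V(H)] : H.zagreb = ∑ v : V(H), H.degree v ^ 2 := by
  rw [zagreb, ← finsum_set_coe_eq_finsum_mem V(H), finsum_eq_sum_of_fintype]

lemma IsUniform.card_inc [Fintype V(H)] (h : H.IsUniform k) (e : E(H)) :
    #{v | H.Inc v e} = k := by
  have : (e : Set α) =
      ((univ.filter fun v : V(H) ↦ H.Inc v e).map (Function.Embedding.subtype _) : Set α) := by
    ext v
    simp only [coe_map, Set.mem_image, mem_coe, mem_filter, mem_univ, true_and,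
      Function.Embedding.subtype_apply]
    constructor
    · intro hv
      exact ⟨⟨v, mem_vertexSet_of_mem_edgeSet e.2 hv⟩, hv, rfl⟩
    · rintro ⟨v, hv, rfl⟩
      exact hv
  have h1 := h e e.2
  rw [this, Set.encard_coe_eq_coe_finsetCard, card_map] at h1
  exact_mod_cast h1

/-- Handshake lemma. For n = m(k-1) - 1 it says that the excess is m + 1. -/
lemma IsUniform.excess_add_card [Fintype V(H)] [Fintype E(H)] (h : H.IsUniform k)
    (hpos : ∀ v : V(H), 0 < H.degree v) :
    Incidence.excess H.Inc univ + Fintype.card V(H) = k * Fintype.card E(H) := by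
  have h1 := Incidence.sum_deg (I := H.Inc) univ
  simp only [h.card_inc, sum_const, smul_eq_mul, card_univ] at h1
  rw [mul_comm, ← h1, Incidence.excess, Fintype.card_eq_sum_ones, ← sum_add_distrib]
  refine sum_congr rfl fun v _ ↦ ?_
  have := hpos v
  rw [deg_inc]
  omega

/-- Expansion of d^2 = (d-1)^2 + 2(d-1) + 1; only the first sum varies among bicyclic hypergraphs
with given parameters. -/
lemma zagreb_eq [Fintype V(H)] [Fintype E(H)] (hpos : ∀ v : V(H), 0 < H.degree v) :
    H.zagreb = ∑ v, (Incidence.deg H.Inc univ v - 1) ^ 2 + 2 * Incidence.excess H.Inc univ +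
      Fintype.card V(H) := by
  rw [zagreb_eq_sum, Incidence.excess, mul_sum, Fintype.card_eq_sum_ones, ← sum_add_distrib,
    ← sum_add_distrib]
  refine sum_congr rfl fun v _ ↦ ?_
  rw [deg_inc]
  obtain ⟨d, hd⟩ := Nat.exists_eq_add_of_lt (hpos v)
  rw [hd]
  simp only [zero_add, Nat.add_sub_cancel]
  ring

lemma IsConnected.connected_inc [Fintype E(H)] (h : H.IsConnected) (hne : ∀ e ∈ E(H), e.Nonempty) :
    Incidence.Connected H.Inc := by
  intro C ⟨e, he⟩ hC
  obtain ⟨f, hf⟩ : ∃ f, f ∉ C := by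
    by_contra! hall
    exact hC (eq_univ_iff_forall.2 hall)
  obtain ⟨x, hx⟩ := hne e e.2
  obtain ⟨y, hy⟩ := hne f f.2
  have hpath := h.2 x (mem_vertexSet_of_mem_edgeSet e.2 hx) y (mem_vertexSet_of_mem_edgeSet f.2 hy)
  by_contra! hcon
  have hclosed : ∀ z, Relation.ReflTransGen H.Adj x z → ∃ e ∈ C, z ∈ (e : Set α) := by
    intro z hz
    induction hz with
    | refl => exact ⟨e, he, hx⟩
    | @tail p q _ hpq ih =>
      obtain ⟨e', he', hp⟩ := ih
      obtain ⟨f', hf', hpf, hqf⟩ := hpq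
      refine ⟨⟨f', hf'⟩, ?_, hqf⟩
      by_contra hfC
      have h1 := hcon ⟨f', hf'⟩ hfC ⟨p, mem_vertexSet_of_mem_edgeSet hf' hpf⟩ hpf
      exact h1.not_gt (Incidence.deg_pos_iff.2 ⟨e', he', hp⟩)
  obtain ⟨e', he', hye⟩ := hclosed y hpath
  have h1 := hcon f hf ⟨y, mem_vertexSet_of_mem_edgeSet f.2 hy⟩ hy
  exact h1.not_gt (Incidence.deg_pos_iff.2 ⟨e', he', hye⟩)

lemma IsConnected.degree_pos [Fintype E(H)] (h : H.IsConnected) (hV : V(H).Nontrivial) (v : V(H)) :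
    0 < H.degree v := by
  obtain ⟨y, hy, hne⟩ := hV.exists_ne (v : α)
  rcases Relation.ReflTransGen.cases_head (h.2 v v.2 y hy) with heq | ⟨z, ⟨e, he, hv, -⟩, -⟩
  · exact absurd heq.symm hne
  · rw [← deg_inc, Incidence.deg_pos_iff]
    exact ⟨⟨e, he⟩, mem_univ _, hv⟩

lemma girthGE_inc (h : ∀ l, H.HasHypercycle l → g ≤ l) : Incidence.GirthGE H.Inc g := by
  intro l v e hl hv he hinc
  refine h l ⟨hl, fun i ↦ v i, fun i ↦ e i, fun i hi j hj hij ↦ hv hi hj (Subtype.ext hij),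
    fun i hi j hj hij ↦ he hi hj (Subtype.ext hij), fun i hi ↦ ⟨(e i).2, hinc i hi⟩⟩

lemma IsLinear.three_le (h : H.IsLinear) {l : ℕ} (hl : H.HasHypercycle l) : 3 ≤ l := by
  obtain ⟨h2, v, e, hv, he, hinc⟩ := hl
  by_contra! hlt
  obtain rfl : l = 2 := by omega
  obtain ⟨he0, hv0, hv1⟩ := hinc 0 (by omega)
  obtain ⟨he1, hv1', hv0'⟩ := hinc 1 (by omega)
  have hne : e 0 ≠ e 1 := fun heq ↦ by
    have := he (show 0 < 2 by omega) (show 1 < 2 by omega) heq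
    omega
  have := hv (show 0 < 2 by omega) (show 1 < 2 by omega)
    (h _ he0 _ he1 hne ⟨hv0, hv0'⟩ ⟨hv1, hv1'⟩)
  omega

end Incidence

/-! ### Theta hypergraphs with equal parameters are isomorphic. -/

/-- `H` is a theta hypergraph with vertices and edges labelled by `γ` and `ε`. -/
structure IsTheta {α : Type*} (H : Hypergraph α) (k g t : ℕ) (γ : ℕ × ℕ → α)
    (ε : ℕ × ℕ → Set α) : Prop where
  injOn : Set.InjOn γ (thetaVerts g)
  bijOn : Set.BijOn ε (thetaEdges g t) E(H)
  mem_iff : ∀ x ∈ thetaVerts g, ∀ y ∈ thetaEdges g t, γ x ∈ ε y ↔ ThetaInc g x y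
  mem_image : ∀ e ∈ E(H), ∀ f ∈ E(H), ∀ v, e ≠ f → v ∈ e → v ∈ f → v ∈ γ '' thetaVerts g
  exists_mem : ∀ v ∈ V(H), ∃ e ∈ E(H), v ∈ e
  isUniform : H.IsUniform k

lemma exists_thetaInc {g : ℕ} (h3 : 3 ≤ g) (t : ℕ) {x : ℕ × ℕ} (hx : x ∈ thetaVerts g) :
    ∃ y ∈ thetaEdges g t, ThetaInc g x y := by
  obtain ⟨a, i⟩ := x
  obtain ⟨h1, h2, hig, h4⟩ := hx
  simp only [thetaEdges, ThetaInc, Set.mem_ofPred_eq, Prod.exists] at *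
  by_cases hi : i = 0
  · exact ⟨a, 1, by omega⟩
  · exact ⟨a, i - 1, by omega⟩

namespace IsTheta

variable {α β : Type*} {H : Hypergraph α} {H' : Hypergraph β} {k g t : ℕ}
  {γ : ℕ × ℕ → α} {ε : ℕ × ℕ → Set α} {γ' : ℕ × ℕ → β} {ε' : ℕ × ℕ → Set β}

lemma inter_eq (h : H.IsTheta k g t γ ε) {y : ℕ × ℕ} (hy : y ∈ thetaEdges g t) :
    ε y ∩ γ '' thetaVerts g = γ '' {x ∈ thetaVerts g | ThetaInc g x y} := by
  ext v
  constructor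
  · rintro ⟨hv, x, hx, rfl⟩
    exact ⟨x, ⟨hx, (h.mem_iff x hx y hy).1 hv⟩, rfl⟩
  · rintro ⟨x, ⟨hx, hxy⟩, rfl⟩
    exact ⟨(h.mem_iff x hx y hy).2 hxy, x, hx, rfl⟩

lemma encard_diff_add (h : H.IsTheta k g t γ ε) {y : ℕ × ℕ} (hy : y ∈ thetaEdges g t) :
    (ε y \ γ '' thetaVerts g).encard + {x ∈ thetaVerts g | ThetaInc g x y}.encard = k := by
  rw [← h.isUniform _ (h.bijOn.mapsTo hy), ← Set.encard_sdiff_add_encard_inter (ε y)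
    (γ '' thetaVerts g), h.inter_eq hy, (h.injOn.mono (Set.sep_subset _ _)).encard_image]

/-- Corresponding edges have `k` vertices each and equally many labelled ones, hence equally many
unlabelled ones. -/
lemma exists_bijOn_diff (h : H.IsTheta k g t γ ε) (h' : H'.IsTheta k g t γ' ε') {y : ℕ × ℕ}
    (hy : y ∈ thetaEdges g t) :
    ∃ f : α → β, Set.BijOn f (ε y \ γ '' thetaVerts g) (ε' y \ γ' '' thetaVerts g) := by
  have h1 := h.encard_diff_add hy
  have h2 := h'.encard_diff_add hy
  have : Nonempty β := ⟨γ' (0, 0)⟩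
  refine Set.Finite.exists_bijOn_of_encard_eq ?_ ?_
  · refine Set.encard_ne_top_iff.1 fun htop ↦ ?_
    rw [htop, top_add] at h1
    exact ENat.top_ne_natCast _ h1
  · refine (ENat.add_left_injective_of_ne_top fun htop ↦ ?_) (h1.trans h2.symm)
    rw [htop, add_top] at h1
    exact ENat.top_ne_natCast _ h1

/-- Labelled vertices are matched by label. An unlabelled vertex lies in exactly one edge, so the
bijections of `exists_bijOn_diff` can be glued without conflict. -/
lemma exists_injOn (h3 : 3 ≤ g) (h : H.IsTheta k g t γ ε) (h' : H'.IsTheta k g t γ' ε') :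
    ∃ f : α → β, Set.BijOn f V(H) V(H') ∧
      ∀ v ∈ V(H), ∀ y ∈ thetaEdges g t, f v ∈ ε' y ↔ v ∈ ε y := by
  classical
  have : Nonempty β := ⟨γ' (0, 0)⟩
  choose! p hp using fun y hy ↦ exists_bijOn_diff h h' (y := y) hy
  have hlab : ∀ v ∈ V(H), ∃ y ∈ thetaEdges g t, v ∈ ε y := fun v hv ↦ by
    obtain ⟨e, he, hve⟩ := h.exists_mem v hv
    obtain ⟨y, hy, rfl⟩ := h.bijOn.surjOn he
    exact ⟨y, hy, hve⟩
  have huniq : ∀ v ∉ γ '' thetaVerts g, ∀ y ∈ thetaEdges g t, ∀ z ∈ thetaEdges g t, v ∈ ε y →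
      v ∈ ε z → y = z := fun v hv y hy z hz hvy hvz ↦ by
    by_contra hne
    exact hv (h.mem_image _ (h.bijOn.mapsTo hy) _ (h.bijOn.mapsTo hz) v
      (fun heq ↦ hne (h.bijOn.injOn hy hz heq)) hvy hvz)
  have huniq' : ∀ v ∉ γ' '' thetaVerts g, ∀ y ∈ thetaEdges g t, ∀ z ∈ thetaEdges g t, v ∈ ε' y →
      v ∈ ε' z → y = z := fun v hv y hy z hz hvy hvz ↦ by
    by_contra hne
    exact hv (h'.mem_image _ (h'.bijOn.mapsTo hy) _ (h'.bijOn.mapsTo hz) v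
      (fun heq ↦ hne (h'.bijOn.injOn hy hz heq)) hvy hvz)
  choose! lab hlabE hlab using hlab
  choose! inv hinvV hinv using fun v (hv : v ∈ γ '' thetaVerts g) ↦ hv
  set f : α → β := fun v ↦ if v ∈ γ '' thetaVerts g then γ' (inv v) else p (lab v) v with hf
  have hfγ : ∀ x ∈ thetaVerts g, f (γ x) = γ' x := fun x hx ↦ by
    have hm : γ x ∈ γ '' thetaVerts g := ⟨x, hx, rfl⟩
    rw [hf]
    simp only [if_pos hm]
    rw [h.injOn (hinvV _ hm) hx (hinv _ hm)]
  have hfp : ∀ y ∈ thetaEdges g t, ∀ v ∈ ε y, v ∉ γ '' thetaVerts g → f v = p y v :=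
    fun y hy v hvy hv ↦ by
      have hvV := mem_vertexSet_of_mem_edgeSet (h.bijOn.mapsTo hy) hvy
      rw [hf]
      simp only [if_neg hv]
      rw [huniq v hv _ (hlabE v hvV) y hy (hlab v hvV) hvy]
  have hfp' : ∀ v ∈ V(H), v ∉ γ '' thetaVerts g →
      f v = p (lab v) v ∧ f v ∈ ε' (lab v) \ γ' '' thetaVerts g := fun v hvV hv ↦ by
    have := hfp _ (hlabE v hvV) v (hlab v hvV) hv
    exact ⟨this, this ▸ (hp _ (hlabE v hvV)).mapsTo ⟨hlab v hvV, hv⟩⟩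
  have hmem : ∀ v ∈ V(H), ∀ y ∈ thetaEdges g t, f v ∈ ε' y ↔ v ∈ ε y := fun v hvV y hy ↦ by
    by_cases hv : v ∈ γ '' thetaVerts g
    · obtain ⟨x, hx, rfl⟩ := hv
      rw [hfγ x hx, h.mem_iff x hx y hy, h'.mem_iff x hx y hy]
    · obtain ⟨-, hf1, hf2⟩ := hfp' v hvV hv
      constructor
      · intro hfy
        rw [← huniq' _ hf2 _ (hlabE v hvV) y hy hf1 hfy]
        exact hlab v hvV
      · intro hvy
        rwa [← huniq v hv _ (hlabE v hvV) y hy (hlab v hvV) hvy]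
  refine ⟨f, ⟨fun v hv ↦ ?_, fun v hv v' hv' heq ↦ ?_, fun v' hv' ↦ ?_⟩, hmem⟩
  · exact mem_vertexSet_of_mem_edgeSet (h'.bijOn.mapsTo (hlabE v hv))
      ((hmem v hv _ (hlabE v hv)).2 (hlab v hv))
  · by_cases hc : v ∈ γ '' thetaVerts g <;> by_cases hc' : v' ∈ γ '' thetaVerts g
    · obtain ⟨x, hx, rfl⟩ := hc
      obtain ⟨x', hx', rfl⟩ := hc'
      rw [hfγ x hx, hfγ x' hx'] at heq
      rw [h'.injOn hx hx' heq]
    · obtain ⟨x, hx, rfl⟩ := hc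
      rw [hfγ x hx] at heq
      exact absurd ⟨x, hx, heq⟩ (hfp' v' hv' hc').2.2
    · obtain ⟨x, hx, rfl⟩ := hc'
      rw [hfγ x hx] at heq
      exact absurd ⟨x, hx, heq.symm⟩ (hfp' v hv hc).2.2
    · have h1 := hfp' v hv hc
      have h2 := hfp' v' hv' hc'
      have hv'' : v' ∈ ε (lab v) := (hmem v' hv' _ (hlabE v hv)).1 (heq ▸ h1.2.1)
      have h4 := hfp _ (hlabE v hv) v' hv'' hc'
      exact (hp _ (hlabE v hv)).injOn ⟨hlab v hv, hc⟩ ⟨hv'', hc'⟩ (by rw [← h1.1, ← h4, heq])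
  · by_cases hc : v' ∈ γ' '' thetaVerts g
    · obtain ⟨x, hx, rfl⟩ := hc
      obtain ⟨y, hy, hxy⟩ := exists_thetaInc h3 t hx
      exact ⟨γ x, mem_vertexSet_of_mem_edgeSet (h.bijOn.mapsTo hy) ((h.mem_iff x hx y hy).2 hxy),
        hfγ x hx⟩
    · obtain ⟨e, he, hve⟩ := h'.exists_mem v' hv'
      obtain ⟨y, hy, rfl⟩ := h'.bijOn.surjOn he
      obtain ⟨v, hv, rfl⟩ := (hp y hy).surjOn ⟨hve, hc⟩
      exact ⟨v, mem_vertexSet_of_mem_edgeSet (h.bijOn.mapsTo hy) hv.1, hfp y hy v hv.1 hv.2⟩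

lemma isIso (h3 : 3 ≤ g) (h : H.IsTheta k g t γ ε) (h' : H'.IsTheta k g t γ' ε') :
    H.IsIso H' := by
  obtain ⟨f, hf, hmem⟩ := exists_injOn h3 h h'
  have himg : ∀ y ∈ thetaEdges g t, f '' ε y = ε' y := fun y hy ↦ by
    ext v'
    constructor
    · rintro ⟨v, hv, rfl⟩
      exact (hmem v (mem_vertexSet_of_mem_edgeSet (h.bijOn.mapsTo hy) hv) y hy).2 hv
    · intro hv'
      obtain ⟨v, hv, rfl⟩ := hf.surjOn (mem_vertexSet_of_mem_edgeSet (h'.bijOn.mapsTo hy) hv')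
      exact ⟨v, (hmem v hv y hy).1 hv', rfl⟩
  refine ⟨hf.equiv f, fun s ↦ ?_⟩
  have hs : Subtype.val '' (hf.equiv f '' s) = f '' (Subtype.val '' s) := by
    rw [Set.image_image, Set.image_image]
    rfl
  rw [hs]
  constructor
  · intro he
    obtain ⟨y, hy, hye⟩ := h.bijOn.surjOn he
    rw [← hye, himg y hy]
    exact h'.bijOn.mapsTo hy
  · intro he
    obtain ⟨y, hy, hye⟩ := h'.bijOn.surjOn he
    rw [← himg y hy, hf.injOn.image_eq_image_iff] at hye
    · rw [← hye]
      exact h.bijOn.mapsTo hy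
    · exact (h.bijOn.mapsTo hy).subset_vertexSet
    · rintro _ ⟨v, -, rfl⟩
      exact v.2

end IsTheta

end Hypergraph

/-! ### Degrees, connectedness and girth of theta hypergraphs. -/

/-- The label of the `i`-th node of the `a`-th path. -/
def thetaNode (g a i : ℕ) : ℕ × ℕ := if i = 0 ∨ i = g then (0, i) else (a, i)

lemma thetaNode_snd (g a i : ℕ) : (thetaNode g a i).2 = i := by
  unfold thetaNode
  split_ifs <;> rfl

lemma thetaNode_fst (g a i : ℕ) : (thetaNode g a i).1 = if i = 0 ∨ i = g then 0 else a := by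
  unfold thetaNode
  split_ifs <;> rfl

lemma thetaNode_mem_thetaVerts {g a i : ℕ} (ha : a < 3) (hi : i ≤ g) (h : i % 2 = 0) :
    thetaNode g a i ∈ thetaVerts g := by
  simp only [thetaVerts, Set.mem_ofPred_eq, thetaNode_snd, thetaNode_fst]
  split_ifs <;> omega

lemma thetaNode_mem_thetaEdges {g a i : ℕ} (t : ℕ) (ha : a < 3) (hi : i ≤ g) (h : i % 2 = 1) :
    thetaNode g a i ∈ thetaEdges g t := by
  simp only [thetaEdges, Set.mem_ofPred_eq, thetaNode_snd, thetaNode_fst]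
  split_ifs <;> omega

lemma thetaInc_thetaNode {g a i j : ℕ} (hj : j ≠ 0) (h : i + 1 = j ∨ j + 1 = i) :
    ThetaInc g (thetaNode g a i) (thetaNode g a j) := by
  simp only [ThetaInc, thetaNode_snd, thetaNode_fst]
  split_ifs <;> omega

lemma thetaNode_zero (g a : ℕ) : thetaNode g a 0 = (0, 0) := by
  simp [thetaNode]

/-- The `j`-th node of the cycle of length `2 * g` formed by the `a`-th and the `b`-th path. -/
def thetaCycle (g a b j : ℕ) : ℕ × ℕ :=
  if j ≤ g then thetaNode g a j else thetaNode g b (2 * g - j)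

lemma injOn_thetaCycle {g a b : ℕ} (hab : a ≠ b) :
    Set.InjOn (thetaCycle g a b) (Set.Iio (2 * g)) := by
  intro i hi j hj hij
  simp only [Set.mem_Iio] at hi hj
  have h1 := congrArg Prod.fst hij
  have h2 := congrArg Prod.snd hij
  unfold thetaCycle at h1 h2
  split_ifs at h1 h2 <;> simp only [thetaNode_snd, thetaNode_fst] at h1 h2 <;>
    split_ifs at h1 <;> omega

namespace Hypergraph

lemma thetaEdges_encard {g t : ℕ} (h3 : 3 ≤ g) :
    (thetaEdges g t).encard = (3 * g / 2 + t : ℕ) := by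
  have : thetaEdges g t = ((((Finset.range 3 ×ˢ Finset.range (g / 2)).image
      fun p ↦ (p.1, 2 * p.2 + 1)) ∪ ((Finset.range (g % 2)).image fun _ ↦ (0, g))) ∪
      (Finset.range t).image fun j ↦ (3 + j, 1) : Finset (ℕ × ℕ)) := by
    ext ⟨a, i⟩
    simp only [thetaEdges, Set.mem_ofPred_eq, Finset.coe_union, Finset.coe_image, Set.mem_union,
      Set.mem_image, Finset.mem_coe, Finset.mem_product, Finset.mem_range, Prod.mk.injEq,
      Prod.exists]
    constructor
    · rintro ⟨h1, ⟨h2, h4, h5⟩ | h2⟩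
      · rcases eq_or_lt_of_le h4 with rfl | hlt
        · exact .inl (.inr ⟨0, by omega, by omega, rfl⟩)
        · exact .inl (.inl ⟨a, i / 2, by omega⟩)
      · exact .inr ⟨a - 3, by omega⟩
    · rintro ((⟨b, s, h1, h2, h3⟩ | ⟨b, h1, h2, h3⟩) | ⟨b, h1, h2, h3⟩) <;> omega
  rw [this, Set.encard_coe_eq_coe_finsetCard, Finset.card_union_of_disjoint,
    Finset.card_union_of_disjoint, Finset.card_image_of_injOn, Finset.card_image_of_injOn,
    Finset.card_image_of_injOn, Finset.card_product, Finset.card_range, Finset.card_range,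
    Finset.card_range, Finset.card_range]
  · congr 1
    omega
  · intro i _ j _ hij
    simpa using hij
  · intro i hi j hj hij
    simp only [Finset.coe_range, Set.mem_Iio] at hi hj
    omega
  · rintro ⟨a, i⟩ _ ⟨b, j⟩ _ hij
    simpa using hij
  · simp only [Finset.disjoint_left, Finset.mem_image, Finset.mem_product, Finset.mem_range,
      Prod.exists]
    rintro _ ⟨a, s, h1, rfl⟩ ⟨b, h2, h4⟩
    simp only [Prod.mk.injEq] at h4
    omega
  · simp only [Finset.disjoint_left, Finset.mem_image, Finset.mem_product, Finset.mem_range,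
      Prod.exists, Finset.mem_union]
    rintro _ (⟨a, s, h1, rfl⟩ | ⟨a, h1, rfl⟩) ⟨b, h2, h4⟩ <;>
    · simp only [Prod.mk.injEq] at h4
      omega

lemma thetaVerts_eq {g : ℕ} (h3 : 3 ≤ g) : thetaVerts g = (insert (0, 0)
      (((Finset.range 3 ×ˢ Finset.range ((g - 1) / 2)).image fun p ↦ (p.1, 2 * p.2 + 2)) ∪
        (Finset.range (1 - g % 2)).image fun _ ↦ (0, g)) : Finset (ℕ × ℕ)) := by
  ext ⟨a, i⟩
  simp only [thetaVerts, Set.mem_ofPred_eq, Finset.coe_insert, Finset.coe_union, Finset.coe_image,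
    Set.mem_insert_iff, Set.mem_union, Set.mem_image, Finset.mem_coe, Finset.mem_product,
    Finset.mem_range, Prod.mk.injEq, Prod.exists]
  constructor
  · rintro ⟨h1, h2, h4, h5⟩
    by_cases h0 : i = 0
    · omega
    · rcases eq_or_lt_of_le h4 with rfl | hlt
      · exact .inr (.inr ⟨0, by omega, by omega, rfl⟩)
      · exact .inr (.inl ⟨a, i / 2 - 1, by omega⟩)
  · rintro (h | ⟨b, s, h1, h2, h3⟩ | ⟨b, h1, h2, h3⟩) <;> omega

/-- The three terms come from the root, the inner vertices of the three paths, and the far end,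
which is a vertex only for even `g`. -/
lemma sum_thetaVerts {g : ℕ} (h3 : 3 ≤ g) (F : ℕ × ℕ → ℕ) {s : Finset (ℕ × ℕ)}
    (hs : (s : Set (ℕ × ℕ)) = thetaVerts g) {c : ℕ}
    (hc : ∀ a i, a < 3 → 0 < i → i < g → i % 2 = 0 → F (a, i) = c) :
    ∑ x ∈ s, F x = F (0, 0) + 3 * ((g - 1) / 2) * c + (1 - g % 2) * F (0, g) := by
  rw [thetaVerts_eq h3, Finset.coe_inj] at hs
  rw [hs, Finset.sum_insert, Finset.sum_union, Finset.sum_image, Finset.sum_image,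
    Finset.sum_congr rfl (g := fun _ ↦ c)]
  · simp
    ring
  · rintro ⟨a, s⟩ hp
    simp only [Finset.mem_product, Finset.mem_range] at hp
    exact hc _ _ hp.1 (by omega) (by omega) (by omega)
  · intro i hi j hj hij
    simp only [Finset.coe_range, Set.mem_Iio] at hi hj
    omega
  · rintro ⟨a, i⟩ _ ⟨b, j⟩ _ hij
    simpa using hij
  · simp only [Finset.disjoint_left, Finset.mem_image, Finset.mem_product, Finset.mem_range,
      Prod.exists]
    rintro _ ⟨a, s, h1, rfl⟩ ⟨b, h2, h4⟩
    simp only [Prod.mk.injEq] at h4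
    omega
  · simp only [Finset.mem_image, Finset.mem_product, Finset.mem_range, Prod.exists,
      Finset.mem_union, Prod.mk.injEq]
    rintro (⟨a, s, h1, h2, h4⟩ | ⟨b, h1, h2, h4⟩) <;> omega

namespace IsTheta

variable {α : Type*} {H : Hypergraph α} {k g t : ℕ} {γ : ℕ × ℕ → α} {ε : ℕ × ℕ → Set α}

lemma encard_edgeSet (h : H.IsTheta k g t γ ε) (h3 : 3 ≤ g) :
    E(H).encard = (3 * g / 2 + t : ℕ) := by
  rw [← h.bijOn.image_eq, h.bijOn.injOn.encard_image, thetaEdges_encard h3]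

lemma degree_label (h : H.IsTheta k g t γ ε) {x : ℕ × ℕ} (hx : x ∈ thetaVerts g) :
    H.degree (γ x) = {y ∈ thetaEdges g t | ThetaInc g x y}.ncard := by
  have : {e | e ∈ E(H) ∧ γ x ∈ e} = ε '' {y ∈ thetaEdges g t | ThetaInc g x y} := by
    ext e
    constructor
    · rintro ⟨he, hxe⟩
      obtain ⟨y, hy, rfl⟩ := h.bijOn.surjOn he
      exact ⟨y, ⟨hy, (h.mem_iff x hx y hy).1 hxe⟩, rfl⟩
    · rintro ⟨y, ⟨hy, hxy⟩, rfl⟩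
      exact ⟨h.bijOn.mapsTo hy, (h.mem_iff x hx y hy).2 hxy⟩
  rw [degree, this, (h.bijOn.injOn.mono (Set.sep_subset _ _)).ncard_image]

lemma degree_root (h : H.IsTheta k g t γ ε) (h3 : 3 ≤ g) : H.degree (γ (0, 0)) = t + 3 := by
  rw [h.degree_label (x := (0, 0)) ⟨rfl, by simp, by simp, fun _ ↦ rfl⟩]
  have : {y ∈ thetaEdges g t | ThetaInc g (0, 0) y} =
      ((Finset.range (t + 3)).image fun a ↦ (a, 1) : Finset (ℕ × ℕ)) := by
    ext ⟨a, i⟩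
    simp only [thetaEdges, ThetaInc, Set.mem_ofPred_eq, Finset.coe_image, Set.mem_image,
      Finset.mem_coe, Finset.mem_range, Prod.mk.injEq]
    constructor
    · intro h
      exact ⟨a, by omega, rfl, by omega⟩
    · rintro ⟨b, hb, rfl, rfl⟩
      grind
  rw [this, Set.ncard_coe_finset, Finset.card_image_of_injective, Finset.card_range]
  exact fun a b hab ↦ by simpa using hab

lemma degree_joint (h : H.IsTheta k g t γ ε) (h3 : 3 ≤ g) (heven : g % 2 = 0) :
    H.degree (γ (0, g)) = 3 := by
  rw [h.degree_label (x := (0, g)) ⟨heven, by simp, by simp, fun _ ↦ rfl⟩]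
  have : {y ∈ thetaEdges g t | ThetaInc g (0, g) y} =
      ((Finset.range 3).image fun a ↦ (a, g - 1) : Finset (ℕ × ℕ)) := by
    ext ⟨a, i⟩
    simp only [thetaEdges, ThetaInc, Set.mem_ofPred_eq, Finset.coe_image, Set.mem_image,
      Finset.mem_coe, Finset.mem_range, Prod.mk.injEq]
    constructor
    · intro h
      exact ⟨a, by omega, rfl, by omega⟩
    · rintro ⟨b, hb, rfl, rfl⟩
      grind
  rw [this, Set.ncard_coe_finset, Finset.card_image_of_injective, Finset.card_range]
  exact fun a b hab ↦ by simpa using hab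

lemma degree_inner (h : H.IsTheta k g t γ ε) {a i : ℕ} (ha : a < 3) (h0 : 0 < i) (hi : i < g)
    (heven : i % 2 = 0) : H.degree (γ (a, i)) = 2 := by
  rw [h.degree_label (x := (a, i)) ⟨heven, ha, hi.le, by dsimp only; omega⟩]
  have : {y ∈ thetaEdges g t | ThetaInc g (a, i) y} =
      ({thetaNode g a (i - 1), thetaNode g a (i + 1)} : Set (ℕ × ℕ)) := by
    ext ⟨b, j⟩
    simp only [thetaEdges, ThetaInc, Set.mem_ofPred_eq, Set.mem_insert_iff, Set.mem_singleton_iff,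
      Prod.ext_iff, thetaNode_snd, thetaNode_fst]
    grind
  rw [this, Set.ncard_pair]
  intro heq
  have := congrArg Prod.snd heq
  simp only [thetaNode_snd] at this
  omega

lemma degree_eq_one (h : H.IsTheta k g t γ ε) {v : α} (hv : v ∈ V(H))
    (hc : v ∉ γ '' thetaVerts g) : H.degree v = 1 := by
  obtain ⟨e, he, hve⟩ := h.exists_mem v hv
  have : {e | e ∈ E(H) ∧ v ∈ e} = {e} := by
    ext f
    constructor
    · rintro ⟨hf, hvf⟩
      by_contra hne
      exact hc (h.mem_image f hf e he v hne hvf hve)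
    · rintro rfl
      exact ⟨he, hve⟩
  rw [degree, this, Set.ncard_singleton]

lemma label_mem (h : H.IsTheta k g t γ ε) (h3 : 3 ≤ g) {x : ℕ × ℕ} (hx : x ∈ thetaVerts g) :
    γ x ∈ V(H) := by
  obtain ⟨y, hy, hxy⟩ := exists_thetaInc h3 t hx
  exact mem_vertexSet_of_mem_edgeSet (h.bijOn.mapsTo hy) ((h.mem_iff x hx y hy).2 hxy)

lemma sum_degree (h : H.IsTheta k g t γ ε) (h3 : 3 ≤ g) [Fintype V(H)] (F : ℕ → ℕ)
    (hF : F 0 = 0) : ∑ v : V(H), F (H.degree v - 1) =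
      F (t + 2) + 3 * ((g - 1) / 2) * F 1 + (1 - g % 2) * F 2 := by
  classical
  have hmem : ∀ x ∈ thetaVerts g, γ x ∈ V(H) := fun x hx ↦ h.label_mem h3 hx
  obtain ⟨s, hs⟩ : ∃ s : Finset (ℕ × ℕ), (s : Set (ℕ × ℕ)) = thetaVerts g :=
    ⟨_, (thetaVerts_eq h3).symm⟩
  have h1 : ∑ v : V(H), F (H.degree v - 1) = ∑ x ∈ s, F (H.degree (γ x) - 1) := by
    rw [← Finset.sum_image (f := fun v ↦ F (H.degree v - 1)) (g := γ) (hs ▸ h.injOn),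
      Finset.sum_set_coe (f := fun v ↦ F (H.degree v - 1))]
    refine (Finset.sum_subset (fun v hv ↦ ?_) fun v hv hvs ↦ ?_).symm
    · obtain ⟨x, hx, rfl⟩ := Finset.mem_image.1 hv
      exact Set.mem_toFinset.2 (hmem x (hs ▸ Finset.mem_coe.2 hx))
    · rw [h.degree_eq_one (Set.mem_toFinset.1 hv), Nat.sub_self, hF]
      rintro ⟨x, hx, rfl⟩
      exact hvs (Finset.mem_image_of_mem _ (Finset.mem_coe.1 (hs ▸ hx)))
  rw [h1, sum_thetaVerts h3 _ hs (c := F 1) fun a i ha h0 hi he ↦ by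
    rw [h.degree_inner ha h0 hi he], h.degree_root h3]
  rcases Nat.mod_two_eq_zero_or_one g with hg | hg
  · rw [h.degree_joint h3 hg]
    rfl
  · simp [hg]

lemma isConnected (h : H.IsTheta k g t γ ε) (h3 : 3 ≤ g) : H.IsConnected := by
  have h0 : ((0, 0) : ℕ × ℕ) ∈ thetaVerts g := ⟨rfl, by simp, by simp, fun _ ↦ rfl⟩
  have hcore : ∀ i, ∀ a < 3, i ≤ g → i % 2 = 0 →
      Relation.ReflTransGen H.Adj (γ (0, 0)) (γ (thetaNode g a i)) := by
    intro i
    induction i using Nat.strong_induction_on with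
    | _ i ih =>
      intro a ha hi he
      rcases Nat.eq_zero_or_pos i with rfl | hpos
      · rw [thetaNode_zero]
      · have hy := thetaNode_mem_thetaEdges t ha (i := i - 1) (g := g) (by omega) (by omega)
        refine (ih (i - 2) (by omega) a ha (by omega) (by omega)).tail
          ⟨ε (thetaNode g a (i - 1)), h.bijOn.mapsTo hy, ?_, ?_⟩
        · exact (h.mem_iff _ (thetaNode_mem_thetaVerts ha (by omega) (by omega)) _ hy).2
            (thetaInc_thetaNode (by omega) (by omega))
        · exact (h.mem_iff _ (thetaNode_mem_thetaVerts ha (by omega) (by omega)) _ hy).2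
            (thetaInc_thetaNode (by omega) (by omega))
  have hall : ∀ v ∈ V(H), Relation.ReflTransGen H.Adj (γ (0, 0)) v := fun v hv ↦ by
    obtain ⟨e, he, hve⟩ := h.exists_mem v hv
    obtain ⟨y, hy, rfl⟩ := h.bijOn.surjOn he
    by_cases hy3 : y.1 < 3
    · have hy' := hy
      simp only [thetaEdges, Set.mem_ofPred_eq] at hy'
      have hyn : y = thetaNode g y.1 y.2 := by
        ext
        · rw [thetaNode_fst]
          split_ifs <;> omega
        · rw [thetaNode_snd]
      have hx : thetaNode g y.1 (y.2 - 1) ∈ thetaVerts g :=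
        thetaNode_mem_thetaVerts hy3 (by omega) (by omega)
      refine (hcore (y.2 - 1) y.1 hy3 (by omega) (by omega)).tail ⟨_, he, ?_, hve⟩
      refine (h.mem_iff _ hx _ hy).2 ?_
      have := thetaInc_thetaNode (g := g) (a := y.1) (i := y.2 - 1) (j := y.2) (by omega) (by omega)
      rwa [← hyn] at this
    · refine .single ⟨_, he, (h.mem_iff _ h0 _ hy).2 ?_, hve⟩
      simp only [thetaEdges, Set.mem_ofPred_eq] at hy
      simp only [ThetaInc]
      grind
  have : Std.Symm H.Adj := ⟨fun _ _ ↦ Adj.symm⟩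
  have hsymm : ∀ v ∈ V(H), Relation.ReflTransGen H.Adj v (γ (0, 0)) := fun v hv ↦
    Relation.ReflTransGen.stdSymm.symm _ _ (hall v hv)
  exact ⟨⟨_, h.label_mem h3 h0⟩, fun x hx y hy ↦ (hsymm x hx).trans (hall y hy)⟩

lemma hasHypercycle (h : H.IsTheta k g t γ ε) (h3 : 3 ≤ g) : H.HasHypercycle g := by
  have hV : ∀ i ≤ g, thetaCycle g 0 1 (2 * i) ∈ thetaVerts g := fun i hi ↦ by
    unfold thetaCycle
    split_ifs <;> exact thetaNode_mem_thetaVerts (by omega) (by omega) (by omega)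
  have hE : ∀ i < g, thetaCycle g 0 1 (2 * i + 1) ∈ thetaEdges g t := fun i hi ↦ by
    unfold thetaCycle
    split_ifs <;> exact thetaNode_mem_thetaEdges _ (by omega) (by omega) (by omega)
  refine ⟨by omega, fun i ↦ γ (thetaCycle g 0 1 (2 * i)), fun i ↦ ε (thetaCycle g 0 1 (2 * i + 1)),
    fun i hi j hj hij ↦ ?_, fun i hi j hj hij ↦ ?_, fun i hi ↦ ⟨h.bijOn.mapsTo (hE i hi), ?_, ?_⟩⟩
  · simp only [Set.mem_Iio] at hi hj
    have := injOn_thetaCycle (g := g) zero_ne_one (show 2 * i < 2 * g by omega)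
      (show 2 * j < 2 * g by omega) (h.injOn (hV i hi.le) (hV j hj.le) hij)
    omega
  · simp only [Set.mem_Iio] at hi hj
    have := injOn_thetaCycle (g := g) zero_ne_one (show 2 * i + 1 < 2 * g by omega)
      (show 2 * j + 1 < 2 * g by omega) (h.bijOn.injOn (hE i hi) (hE j hj) hij)
    omega
  · refine (h.mem_iff _ (hV i hi.le) _ (hE i hi)).2 ?_
    simp only [thetaCycle, ThetaInc]
    split_ifs <;> simp only [thetaNode_snd, thetaNode_fst] <;> grind
  · have hlt : (i + 1) % g < g := Nat.mod_lt _ (by omega)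
    refine (h.mem_iff _ (hV _ hlt.le) _ (hE i hi)).2 ?_
    rcases Nat.lt_or_ge (i + 1) g with hi' | hi'
    · rw [Nat.mod_eq_of_lt hi']
      simp only [thetaCycle, ThetaInc]
      split_ifs <;> simp only [thetaNode_snd, thetaNode_fst] <;> grind
    · obtain rfl : g = i + 1 := by omega
      rw [Nat.mod_self]
      simp only [thetaCycle, ThetaInc]
      split_ifs <;> simp only [thetaNode_snd, thetaNode_fst] <;> grind

end IsTheta

/-- A set of labels in which every node has two neighbours contains two of the three paths. -/
lemma exists_thetaCycle_subset {g t : ℕ} (h3 : 3 ≤ g) {Q : Set (ℕ × ℕ)} {x₀ : ℕ × ℕ}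
    (h0 : x₀ ∈ thetaVerts g ∩ Q)
    (hV : ∀ x ∈ thetaVerts g ∩ Q, ∃ y ∈ thetaEdges g t ∩ Q, ∃ z ∈ thetaEdges g t ∩ Q,
      y ≠ z ∧ ThetaInc g x y ∧ ThetaInc g x z)
    (hE : ∀ y ∈ thetaEdges g t ∩ Q, ∃ x ∈ thetaVerts g ∩ Q, ∃ z ∈ thetaVerts g ∩ Q,
      x ≠ z ∧ ThetaInc g x y ∧ ThetaInc g z y) :
    ∃ a b, a ≠ b ∧ ∀ j < 2 * g, thetaCycle g a b j ∈ Q := by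
  -- A pendant label meets no labelled vertex except the root, so it cannot have two neighbours.
  have hpend : ∀ y ∈ thetaEdges g t ∩ Q, y.1 < 3 := by
    rintro ⟨a, i⟩ hy
    obtain ⟨⟨b, j⟩, ⟨hx, -⟩, ⟨c, l⟩, ⟨hz, -⟩, hne, h1, h2⟩ := hE _ hy
    have hy := hy.1
    simp only [thetaEdges, thetaVerts, ThetaInc, Set.mem_ofPred_eq, ne_eq, Prod.mk.injEq] at *
    omega
  have hstep : ∀ a < 3, ∀ i, 0 < i → i < g → (a, i) ∈ Q →
      thetaNode g a (i - 1) ∈ Q ∧ thetaNode g a (i + 1) ∈ Q := by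
    have key : ∀ a i, 0 < i → i < g → ∀ y z : ℕ × ℕ, y ∈ Q → z ∈ Q → y ≠ z →
        (y = thetaNode g a (i - 1) ∨ y = thetaNode g a (i + 1)) →
        (z = thetaNode g a (i - 1) ∨ z = thetaNode g a (i + 1)) →
        thetaNode g a (i - 1) ∈ Q ∧ thetaNode g a (i + 1) ∈ Q := by
      rintro a i - - y z hy hz hne (rfl | rfl) (rfl | rfl)
      · exact absurd rfl hne
      · exact ⟨hy, hz⟩
      · exact ⟨hz, hy⟩
      · exact absurd rfl hne
    intro a ha i hi0 hig hQ
    rcases Nat.mod_two_eq_zero_or_one i with hi | hi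
    · obtain ⟨y, hy, z, hz, hne, h1, h2⟩ :=
        hV (a, i) ⟨⟨hi, ha, hig.le, by dsimp only; omega⟩, hQ⟩
      have hnb : ∀ y ∈ thetaEdges g t ∩ Q, ThetaInc g (a, i) y →
          y = thetaNode g a (i - 1) ∨ y = thetaNode g a (i + 1) := by
        rintro ⟨b, j⟩ hy hinc
        have h1 := hpend _ hy
        have h2 := hy.1
        simp only [thetaEdges, ThetaInc, Set.mem_ofPred_eq, Prod.ext_iff, thetaNode_snd,
          thetaNode_fst] at *
        grind
      exact key a i hi0 hig y z hy.2 hz.2 hne (hnb y hy h1) (hnb z hz h2)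
    · obtain ⟨y, hy, z, hz, hne, h1, h2⟩ :=
        hE (a, i) ⟨⟨hi, .inl ⟨ha, hig.le, by dsimp only; omega⟩⟩, hQ⟩
      have hnb : ∀ y ∈ thetaVerts g ∩ Q, ThetaInc g y (a, i) →
          y = thetaNode g a (i - 1) ∨ y = thetaNode g a (i + 1) := by
        rintro ⟨b, j⟩ hy hinc
        have h2 := hy.1
        simp only [thetaVerts, ThetaInc, Set.mem_ofPred_eq, Prod.ext_iff, thetaNode_snd,
          thetaNode_fst] at *
        grind
      exact key a i hi0 hig y z hy.2 hz.2 hne (hnb y hy h1) (hnb z hz h2)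
  have hnode : ∀ a i, 0 < i → i < g → thetaNode g a i = (a, i) := fun a i h0 hi ↦ by
    rw [thetaNode, if_neg (by omega)]
  -- An inner node has just two neighbours on its path, so `Q` propagates in both directions up to
  -- the ends.
  have hpath : ∀ a < 3, ∀ i, 0 < i → i < g → (a, i) ∈ Q → ∀ j ≤ g, thetaNode g a j ∈ Q := by
    intro a ha i hi0 hig hQ
    have hup : ∀ n, i + n ≤ g → thetaNode g a (i + n) ∈ Q := fun n ↦ by
      induction n with
      | zero => intro _; rwa [add_zero, hnode a i hi0 hig]
      | succ n ih =>
        intro hn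
        have := ih (by omega)
        rw [hnode a _ (by omega) (by omega)] at this
        exact (hstep a ha _ (by omega) (by omega) this).2
    have hdown : ∀ n ≤ i, thetaNode g a (i - n) ∈ Q := fun n ↦ by
      induction n with
      | zero => intro _; rwa [Nat.sub_zero, hnode a i hi0 hig]
      | succ n ih =>
        intro hn
        have := ih (by omega)
        rw [hnode a _ (by omega) (by omega)] at this
        exact (hstep a ha _ (by omega) (by omega) this).1
    intro j hj
    rcases le_total i j with hij | hij
    · have := hup (j - i) (by omega)
      rwa [show i + (j - i) = j by omega] at this
    · have := hdown (i - j) (by omega)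
      rwa [show i - (i - j) = j by omega] at this
  obtain ⟨a, ha, i, hi0, hig, hQ⟩ : ∃ a < 3, ∃ i, 0 < i ∧ i < g ∧ (a, i) ∈ Q := by
    obtain ⟨⟨b, j⟩, hy, -, -, -, hinc, -⟩ := hV x₀ h0
    have h1 := hpend _ hy
    by_cases hj : j = g
    · obtain ⟨⟨c, l⟩, hx, -, -, -, hinc', -⟩ := hE _ hy
      refine ⟨c, hx.1.2.1, l, ?_, ?_, hx.2⟩ <;>
      · have := hx.1
        simp only [ThetaInc, thetaVerts, Set.mem_ofPred_eq] at *
        omega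
    · refine ⟨b, h1, j, ?_, ?_, hy.2⟩ <;>
      · have := hy.1
        simp only [thetaEdges, Set.mem_ofPred_eq] at *
        omega
  have hroot : ((0, 0) : ℕ × ℕ) ∈ Q := by
    have := hpath a ha i hi0 hig hQ 0 (by omega)
    rwa [thetaNode_zero] at this
  -- At the root two different neighbours are needed, so a second path is entered.
  obtain ⟨b, hb, hab, hbQ⟩ : ∃ b < 3, a ≠ b ∧ (b, 1) ∈ Q := by
    obtain ⟨⟨b, j⟩, hy, ⟨c, l⟩, hz, hne, h1, h2⟩ :=
      hV (0, 0) ⟨⟨rfl, by simp, by simp, fun _ ↦ rfl⟩, hroot⟩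
    have hb := hpend _ hy
    have hc := hpend _ hz
    simp only [ThetaInc] at h1 h2
    obtain rfl : j = 1 := by omega
    obtain rfl : l = 1 := by omega
    by_cases hab : a = b
    · refine ⟨c, hc, ?_, hz.2⟩
      rintro rfl
      exact hne (by rw [hab])
    · exact ⟨b, hb, hab, hy.2⟩
  refine ⟨a, b, hab, fun j hj ↦ ?_⟩
  unfold thetaCycle
  split_ifs with hjg
  · exact hpath a ha i hi0 hig hQ j hjg
  · exact hpath b hb 1 (by omega) (by omega) hbQ _ (by omega)

namespace IsTheta

variable {α : Type*} {H : Hypergraph α} {k g t : ℕ} {γ : ℕ × ℕ → α} {ε : ℕ × ℕ → Set α}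

/-- The labels on a hypercycle form a set `Q` of at most `2 * l` nodes in which each has two
neighbours; such a set contains the `2 * g` nodes of two full paths. -/
lemma le_of_hasHypercycle (h : H.IsTheta k g t γ ε) (h3 : 3 ≤ g) {l : ℕ}
    (hl : H.HasHypercycle l) : g ≤ l := by
  obtain ⟨h2, v, e, hv, he, hinc⟩ := hl
  have hprev : ∀ i < l, ∃ j < l, e i ≠ e j ∧ v i ∈ e j := fun i hi ↦ by
    by_cases h0 : i = 0
    · subst h0
      refine ⟨l - 1, by omega, fun heq ↦ ?_, ?_⟩
      · have := he (show 0 < l by omega) (show l - 1 < l by omega) heq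
        omega
      · have := (hinc (l - 1) (by omega)).2.2
        rwa [show l - 1 + 1 = l by omega, Nat.mod_self] at this
    · refine ⟨i - 1, by omega, fun heq ↦ ?_, ?_⟩
      · have := he (show i < l by omega) (show i - 1 < l by omega) heq
        omega
      · have := (hinc (i - 1) (by omega)).2.2
        rwa [show i - 1 + 1 = i by omega, Nat.mod_eq_of_lt hi] at this
  have hx : ∀ i < l, ∃ x ∈ thetaVerts g, γ x = v i := fun i hi ↦ by
    obtain ⟨j, hj, hne, hvj⟩ := hprev i hi
    exact h.mem_image _ (hinc i hi).1 _ (hinc j hj).1 _ hne (hinc i hi).2.1 hvj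
  have hy : ∀ i < l, ∃ y ∈ thetaEdges g t, ε y = e i := fun i hi ↦ h.bijOn.surjOn (hinc i hi).1
  choose! x hxV hx using hx
  choose! y hyE hy using hy
  have hxy : ∀ i < l, ∀ j < l, v i ∈ e j → ThetaInc g (x i) (y j) := fun i hi j hj hm ↦ by
    rw [← hx i hi, ← hy j hj] at hm
    exact (h.mem_iff _ (hxV i hi) _ (hyE j hj)).1 hm
  set Q : Finset (ℕ × ℕ) := (Finset.range l).image x ∪ (Finset.range l).image y with hQ
  have hxQ : ∀ i < l, x i ∈ thetaVerts g ∩ Q := fun i hi ↦ ⟨hxV i hi, by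
    rw [hQ, Finset.coe_union]
    exact .inl (Finset.mem_image_of_mem _ (Finset.mem_range.2 hi))⟩
  have hyQ : ∀ i < l, y i ∈ thetaEdges g t ∩ Q := fun i hi ↦ ⟨hyE i hi, by
    rw [hQ, Finset.coe_union]
    exact .inr (Finset.mem_image_of_mem _ (Finset.mem_range.2 hi))⟩
  have hQ' : ∀ p ∈ (Q : Set (ℕ × ℕ)), (∃ i < l, x i = p) ∨ ∃ i < l, y i = p := fun p hp ↦ by
    simpa [hQ] using hp
  obtain ⟨a, b, hab, hcyc⟩ := exists_thetaCycle_subset (t := t) h3 (hxQ 0 (by omega))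
    (fun p hp ↦ by
      rcases hQ' p hp.2 with ⟨i, hi, rfl⟩ | ⟨i, hi, rfl⟩
      · obtain ⟨j, hj, hne, hvj⟩ := hprev i hi
        exact ⟨y i, hyQ i hi, y j, hyQ j hj, fun heq ↦ hne (by rw [← hy i hi, heq, hy j hj]),
          hxy i hi i hi (hinc i hi).2.1, hxy i hi j hj hvj⟩
      · have h1 := hp.1.1
        have h2 := (hyE i hi).1
        omega)
    (fun p hp ↦ by
      rcases hQ' p hp.2 with ⟨i, hi, rfl⟩ | ⟨i, hi, rfl⟩
      · have h1 := hp.1.1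
        have h2 := (hxV i hi).1
        omega
      · have hi' : (i + 1) % l < l := Nat.mod_lt _ (by omega)
        refine ⟨x i, hxQ i hi, x ((i + 1) % l), hxQ _ hi', fun heq ↦ ?_,
          hxy i hi i hi (hinc i hi).2.1, hxy _ hi' i hi (hinc i hi).2.2⟩
        have := hv hi hi' (by rw [← hx i hi, heq, hx _ hi'])
        rcases Nat.lt_or_ge (i + 1) l with h1 | h1
        · rw [Nat.mod_eq_of_lt h1] at this
          omega
        · obtain rfl : l = i + 1 := by omega
          rw [Nat.mod_self] at this
          omega)
  have h1 : ((Finset.range (2 * g)).image (thetaCycle g a b)).card ≤ Q.card :=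
    Finset.card_le_card fun p hp ↦ by
      obtain ⟨j, hj, rfl⟩ := Finset.mem_image.1 hp
      exact hcyc j (Finset.mem_range.1 hj)
  rw [Finset.card_image_of_injOn (by simpa using injOn_thetaCycle hab), Finset.card_range] at h1
  have h2 : Q.card ≤ l + l := (Finset.card_union_le _ _).trans (Nat.add_le_add
    (Finset.card_image_le.trans (by simp)) (Finset.card_image_le.trans (by simp)))
  omega

lemma hasGirth (h : H.IsTheta k g t γ ε) (h3 : 3 ≤ g) : H.HasGirth g :=
  ⟨h.hasHypercycle h3, fun _ hl ↦ h.le_of_hasHypercycle h3 hl⟩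

lemma isLinear (h : H.IsTheta k g t γ ε) (h3 : 3 ≤ g) : H.IsLinear := by
  intro e he f hf hne u hu w hw
  by_contra huw
  have := h.le_of_hasHypercycle h3 (l := 2) ⟨le_rfl, fun i ↦ if i = 0 then u else w,
    fun i ↦ if i = 0 then e else f, ?_, ?_, ?_⟩
  · omega
  · intro i hi j hj hij
    simp only [Set.mem_Iio] at hi hj
    interval_cases i <;> interval_cases j <;> simp_all
  · intro i hi j hj hij
    simp only [Set.mem_Iio] at hi hj
    interval_cases i <;> interval_cases j <;> simp_all
  · intro i hi
    interval_cases i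
    · exact ⟨he, hu.1, hw.1⟩
    · exact ⟨hf, hw.2, hu.2⟩

lemma finite_edgeSet (h : H.IsTheta k g t γ ε) (h3 : 3 ≤ g) : E(H).Finite :=
  Set.finite_of_encard_eq_coe (h.encard_edgeSet h3)

lemma finite_vertexSet (h : H.IsTheta k g t γ ε) (h3 : 3 ≤ g) : V(H).Finite := by
  refine (Set.Finite.sUnion (h.finite_edgeSet h3) fun e he ↦
    Set.finite_of_encard_eq_coe (h.isUniform e he)).subset fun v hv ↦ ?_
  obtain ⟨e, he, hve⟩ := h.exists_mem v hv
  exact ⟨e, he, hve⟩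

lemma degree_pos (h : H.IsTheta k g t γ ε) (h3 : 3 ≤ g) (v : V(H)) : 0 < H.degree v := by
  obtain ⟨e, he, hve⟩ := h.exists_mem v v.2
  exact (Set.ncard_pos ((h.finite_edgeSet h3).subset (Set.sep_subset _ _))).2 ⟨e, he, hve⟩

lemma excess_eq (h : H.IsTheta k g t γ ε) (h3 : 3 ≤ g) [Fintype V(H)] [Fintype E(H)] :
    Incidence.excess H.Inc Finset.univ = 3 * g / 2 + t + 1 := by
  have := h.sum_degree h3 id rfl
  simp only [id] at this
  simp only [Incidence.excess, deg_inc, this]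
  rcases Nat.mod_two_eq_zero_or_one g with hg | hg <;> rw [hg] <;> omega

lemma isBicyclic (h : H.IsTheta k g t γ ε) (h3 : 3 ≤ g) {n m : ℕ} (hm : m = 3 * g / 2 + t)
    (hn : (n : ℤ) = m * (k - 1) - 1) : H.IsBicyclic k n m where
  isUniform := h.isUniform
  isConnected := h.isConnected h3
  encard_edgeSet := hm ▸ h.encard_edgeSet h3
  card_eq := hn
  encard_vertexSet := by
    have := (h.finite_edgeSet h3).fintype
    have := (h.finite_vertexSet h3).fintype
    have h1 := h.isUniform.excess_add_card (h.degree_pos h3)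
    have h2 := h.encard_edgeSet h3
    rw [h.excess_eq h3] at h1
    rw [Set.encard_eq_coe_toFinset_card, Set.toFinset_card] at h2 ⊢
    norm_cast at h2 ⊢
    rw [h2, ← hm] at h1
    zify at h1 ⊢
    linarith

lemma zagreb_add (h : H.IsTheta k g t γ ε) (h3 : 3 ≤ g) {n m : ℕ} (hm : m = 3 * g / 2 + t)
    (hn : (n : ℤ) = m * (k - 1) - 1) :
    H.zagreb + 2 * (g % 2) = (t + 2) ^ 2 + 3 * g / 2 + 1 + 2 * (m + 1) + n := by
  have := (h.finite_edgeSet h3).fintype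
  have := (h.finite_vertexSet h3).fintype
  have h1 := (h.isBicyclic h3 hm hn).encard_vertexSet
  rw [Set.encard_eq_coe_toFinset_card, Set.toFinset_card] at h1
  norm_cast at h1
  have h2 := h.sum_degree h3 (fun d ↦ d ^ 2) rfl
  rw [zagreb_eq (h.degree_pos h3), h.excess_eq h3, h1, hm]
  simp only [deg_inc, h2]
  rcases Nat.mod_two_eq_zero_or_one g with hg | hg <;> rw [hg] <;> omega

end IsTheta

end Hypergraph

/-! ### The hypergraphs C₁ and C₂ are theta hypergraphs. -/

/-- Two labelled edges share at most one labelled vertex. -/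
lemma eq_of_thetaInc {g t : ℕ} (h3 : 3 ≤ g) {x x' y y' : ℕ × ℕ} (hx : x ∈ thetaVerts g)
    (hx' : x' ∈ thetaVerts g) (hy : y ∈ thetaEdges g t) (hy' : y' ∈ thetaEdges g t) (hne : y ≠ y')
    (h1 : ThetaInc g x y) (h2 : ThetaInc g x' y) (h3 : ThetaInc g x y') (h4 : ThetaInc g x' y') :
    x = x' := by
  obtain ⟨b, s⟩ := x
  obtain ⟨b', s'⟩ := x'
  obtain ⟨a, i⟩ := y
  obtain ⟨a', i'⟩ := y'
  simp only [thetaVerts, thetaEdges, ThetaInc, Set.mem_ofPred_eq, ne_eq, Prod.mk.injEq] at *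
  by_cases hs : s = s'
  · subst hs
    refine ⟨?_, rfl⟩
    by_contra hb
    have hs0 : s ≠ 0 := by omega
    have hsg : s ≠ g := by omega
    have hi : i = g := by omega
    have hi' : i' = g := by omega
    omega
  · exfalso
    have hii : i = i' := by omega
    have haa : a ≠ a' := by omega
    have hig : i ≠ g := by omega
    have hs : s = 0 ∨ s = g := by omega
    have hs' : s' = 0 ∨ s' = g := by omega
    omega

namespace Hypergraph

/-- Injectivity of `ε` need not be checked: if two labels gave the same edge, two of its vertices
would be labelled and shared, contradicting `eq_of_thetaInc`. -/
lemma isTheta_of_image_eq {α : Type*} {H : Hypergraph α} {k g t : ℕ} {γ : ℕ × ℕ → α}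
    {ε : ℕ × ℕ → Set α} (h3 : 3 ≤ g) (hk : 2 ≤ k) (injOn : Set.InjOn γ (thetaVerts g))
    (image_eq : ε '' thetaEdges g t = E(H))
    (mem_iff : ∀ x ∈ thetaVerts g, ∀ y ∈ thetaEdges g t, γ x ∈ ε y ↔ ThetaInc g x y)
    (mem_image : ∀ y ∈ thetaEdges g t, ∀ z ∈ thetaEdges g t, ∀ v, y ≠ z → v ∈ ε y → v ∈ ε z →
      v ∈ γ '' thetaVerts g)
    (exists_mem : ∀ v ∈ V(H), ∃ e ∈ E(H), v ∈ e)
    (encard_eq : ∀ y ∈ thetaEdges g t, (ε y).encard = k) : H.IsTheta k g t γ ε where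
  injOn := injOn
  mem_iff := mem_iff
  exists_mem := exists_mem
  isUniform e he := by
    rw [← image_eq] at he
    obtain ⟨y, hy, rfl⟩ := he
    exact encard_eq y hy
  mem_image e he f hf v hne hve hvf := by
    rw [← image_eq] at he hf
    obtain ⟨y, hy, rfl⟩ := he
    obtain ⟨z, hz, rfl⟩ := hf
    exact mem_image y hy z hz v (fun h ↦ hne (h ▸ rfl)) hve hvf
  bijOn := by
    refine ⟨fun y hy ↦ image_eq ▸ Set.mem_image_of_mem ε hy, fun y hy z hz hyz ↦ ?_, image_eq.ge⟩
    by_contra hne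
    obtain ⟨v, hv, w, hw, hvw⟩ := Set.one_lt_encard_iff_nontrivial.1
      (show 1 < (ε y).encard by rw [encard_eq y hy]; exact_mod_cast hk)
    obtain ⟨x, hx, rfl⟩ := mem_image y hy z hz v hne hv (hyz ▸ hv)
    obtain ⟨x', hx', rfl⟩ := mem_image y hy z hz w hne hw (hyz ▸ hw)
    exact hvw (congrArg γ (eq_of_thetaInc h3 hx hx' hy hz hne ((mem_iff x hx y hy).1 hv)
      ((mem_iff x' hx' y hy).1 hw) ((mem_iff x hx z hz).1 (hyz ▸ hv))
      ((mem_iff x' hx' z hz).1 (hyz ▸ hw))))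

/-- The vertices of the `j`-th edge of the `a`-th path, for paths with edges of `K + 1` vertices. -/
def segment (K a j : ℕ) : Set (ℕ × ℕ) := {x | x.1 = a ∧ j * K ≤ x.2 ∧ x.2 ≤ (j + 1) * K}

lemma segment_encard (K a j : ℕ) : (segment K a j).encard = (K + 1 : ℕ) := by
  have : segment K a j = ((Finset.Icc (j * K) ((j + 1) * K)).image (Prod.mk a) :
      Finset (ℕ × ℕ)) := by
    ext ⟨b, z⟩
    simp only [segment, Set.mem_ofPred_eq, Finset.coe_image, Finset.coe_Icc, Set.mem_image,
      Set.mem_Icc, Prod.mk.injEq]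
    constructor
    · rintro ⟨rfl, h⟩
      exact ⟨z, h, rfl, rfl⟩
    · rintro ⟨z, h, rfl, rfl⟩
      exact ⟨rfl, h⟩
  rw [this, Set.encard_coe_eq_coe_finsetCard, Finset.card_image_of_injective _
    (Prod.mk_right_injective a), Nat.card_Icc]
  congr 1
  rw [add_mul]
  omega

lemma mul_mem_segment_iff {K a b j s : ℕ} (hK : 0 < K) :
    (b, s * K) ∈ segment K a j ↔ b = a ∧ (s = j ∨ s = j + 1) := by
  simp only [segment, Set.mem_ofPred_eq, Nat.mul_le_mul_right_iff hK]
  omega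

lemma eq_of_mem_segment {K a b i j : ℕ} {x : ℕ × ℕ} (hi : x ∈ segment K a i)
    (hj : x ∈ segment K b j) (hij : i < j) : x = (a, j * K) := by
  obtain ⟨rfl, -, h1⟩ := hi
  obtain ⟨-, h2, -⟩ := hj
  have := Nat.mul_le_mul_right K (show i + 1 ≤ j from hij)
  ext <;> dsimp only
  omega

lemma exists_mem_segment {K n z : ℕ} (a : ℕ) (hK : 0 < K) (hn : 0 < n) (hz : z ≤ n * K) :
    ∃ j < n, (a, z) ∈ segment K a j := by
  rcases Nat.eq_zero_or_pos z with rfl | h0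
  · exact ⟨0, hn, rfl, by simp, by simp⟩
  · refine ⟨(z - 1) / K, (Nat.div_lt_iff_lt_mul hK).2 (by omega), rfl, ?_, ?_⟩
    · have := Nat.div_mul_le_self (z - 1) K
      dsimp only
      omega
    · have := Nat.lt_mul_of_div_lt (Nat.lt_succ_self ((z - 1) / K)) hK
      dsimp only
      rw [Nat.succ_eq_add_one] at this
      omega

/-- The length of the `a`-th path in `thetaC₁` and `thetaC₂`. -/
def pathLength (p q l a : ℕ) : ℕ := if a = 0 then p else if a = 1 then q else if a = 2 then l else 1

lemma length_append_replicate (p q l t : ℕ) :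
    ([p, q, l] ++ List.replicate t 1).length = 3 + t := by
  rw [List.length_append, List.length_replicate]
  rfl

lemma getElem_eq_pathLength (p q l t a : ℕ) (h : a < ([p, q, l] ++ List.replicate t 1).length) :
    ([p, q, l] ++ List.replicate t 1)[a] = pathLength p q l a := by
  match a with
  | 0 | 1 | 2 => rfl
  | a + 3 => simp [pathLength]

lemma edgeSet_disjointPaths (k p q l t : ℕ) :
    E(disjointPaths k ([p, q, l] ++ List.replicate t 1)) =
      {e | ∃ a j, a < 3 + t ∧ j < pathLength p q l a ∧ e = segment (k - 1) a j} := by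
  ext e
  constructor
  · rintro ⟨a, j, h, hj, rfl⟩
    exact ⟨a, j, length_append_replicate p q l t ▸ h, getElem_eq_pathLength p q l t a h ▸ hj, rfl⟩
  · rintro ⟨a, j, h, hj, rfl⟩
    have h' : a < ([p, q, l] ++ List.replicate t 1).length :=
      length_append_replicate p q l t ▸ h
    exact ⟨a, j, h', (getElem_eq_pathLength p q l t a h').symm ▸ hj, rfl⟩

lemma exists_mem_image_disjointPaths {k p q l t : ℕ} (hk : 2 ≤ k) (hp : 0 < p) (hq : 0 < q)
    (hl : 0 < l) (φ : ℕ × ℕ → ℕ × ℕ) :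
    ∀ v ∈ V((disjointPaths k ([p, q, l] ++ List.replicate t 1)).image φ),
      ∃ e ∈ E((disjointPaths k ([p, q, l] ++ List.replicate t 1)).image φ), v ∈ e := by
  rintro _ ⟨⟨a, z⟩, ⟨ha, hz⟩, rfl⟩
  dsimp only at ha hz
  rw [getElem_eq_pathLength] at hz
  obtain ⟨j, hj, hzj⟩ := exists_mem_segment a (show 0 < k - 1 by omega)
    (by unfold pathLength; split_ifs <;> omega) hz
  refine ⟨φ '' segment (k - 1) a j, image_mem_edgeSet_image ?_, Set.mem_image_of_mem φ hzj⟩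
  rw [edgeSet_disjointPaths]
  exact ⟨a, j, length_append_replicate p q l t ▸ ha, hj, rfl⟩

lemma exists_isTheta_thetaC₁ {k h : ℕ} (t : ℕ) (hk : 3 ≤ k) (hh : 2 ≤ h) :
    ∃ γ ε, (thetaC₁ k h h h t).IsTheta k (2 * h) t γ ε := by
  obtain ⟨K, rfl⟩ : ∃ K, k = K + 1 := ⟨k - 1, by omega⟩
  have hK : 0 < K := by omega
  have hKne : K ≠ 0 := hK.ne'
  set φ : ℕ × ℕ → ℕ × ℕ := fun x ↦ if x.2 = 0 then (0, 0)
    else if x = (1, h * K) ∨ x = (2, h * K) then (0, h * K) else x with hφ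
  have hφ0 : ∀ x : ℕ × ℕ, x.2 = 0 → φ x = (0, 0) := fun x hx ↦ by simp [hφ, hx]
  have hφh : ∀ a, a < 3 → φ (a, h * K) = (0, h * K) := fun a ha ↦ by
    have : h ≠ 0 := by omega
    interval_cases a <;> simp [hφ, this, hKne]
  have hφid : ∀ x : ℕ × ℕ, x.2 ≠ 0 → ¬ (x = (1, h * K) ∨ x = (2, h * K)) → φ x = x :=
    fun x h1 h2 ↦ by simp only [hφ, if_neg h1, if_neg h2]
  have hcases : ∀ x : ℕ × ℕ, x.2 = 0 ∧ φ x = (0, 0) ∨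
      (x = (1, h * K) ∨ x = (2, h * K)) ∧ φ x = (0, h * K) ∨
      x.2 ≠ 0 ∧ ¬ (x = (1, h * K) ∨ x = (2, h * K)) ∧ φ x = x := fun x ↦ by
    by_cases h0 : x.2 = 0
    · exact .inl ⟨h0, hφ0 x h0⟩
    by_cases h1 : x = (1, h * K) ∨ x = (2, h * K)
    · refine .inr (.inl ⟨h1, ?_⟩)
      rcases h1 with rfl | rfl <;> exact hφh _ (by omega)
    · exact .inr (.inr ⟨h0, h1, hφid x h0 h1⟩)
  have hlen : ∀ a, pathLength h h h a = if a < 3 then h else 1 := fun a ↦ by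
    unfold pathLength
    split_ifs <;> omega
  have hH : thetaC₁ (K + 1) h h h t =
      (disjointPaths (K + 1) ([h, h, h] ++ List.replicate t 1)).image φ := rfl
  rw [hH]
  clear_value φ
  clear hφ hH
  -- Node `2 * s` of a path is its path vertex number `s`, at position `s * K`; node `2 * j + 1` is
  -- its edge number `j`.
  refine ⟨fun x ↦ (x.1, x.2 / 2 * K), fun y ↦ φ '' segment K y.1 (y.2 / 2),
    isTheta_of_image_eq (by omega) (by omega) ?_ ?_ ?_ ?_
      (exists_mem_image_disjointPaths (by omega) (by omega) (by omega) (by omega) _) ?_⟩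
  · rintro ⟨a, i⟩ ⟨hi, -⟩ ⟨b, j⟩ ⟨hj, -⟩ hij
    simp only [Prod.mk.injEq, Nat.mul_left_inj hKne] at *
    omega
  · change _ = Set.image φ '' E(disjointPaths _ _)
    rw [edgeSet_disjointPaths, Nat.add_sub_cancel]
    ext e
    constructor
    · rintro ⟨⟨a, i⟩, ⟨hi, hai⟩, rfl⟩
      dsimp only at hi hai
      refine Set.mem_image_of_mem _ ⟨a, i / 2, by omega, ?_, rfl⟩
      rw [hlen]
      split_ifs <;> omega
    · rintro ⟨_, ⟨a, j, ha, hj, rfl⟩, rfl⟩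
      rw [hlen] at hj
      refine ⟨(a, 2 * j + 1), ⟨by dsimp only; omega, ?_⟩, ?_⟩
      · dsimp only
        split_ifs at hj <;> omega
      · dsimp only
        rw [show (2 * j + 1) / 2 = j by omega]
  · rintro ⟨b, s⟩ hx ⟨a, i⟩ hy
    simp only [thetaVerts, thetaEdges, ThetaInc, Set.mem_ofPred_eq] at *
    constructor
    · rintro ⟨z, hz, hzx⟩
      rcases hcases z with ⟨h1, h2⟩ | ⟨h1, h2⟩ | ⟨h1, h1', h2⟩ <;> rw [h2] at hzx
      · simp only [Prod.mk.injEq, zero_eq_mul, hKne, or_false] at hzx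
        have hz' : z = (z.1, 0 * K) := by ext <;> simp [h1]
        rw [hz', mul_mem_segment_iff hK] at hz
        omega
      · simp only [Prod.mk.injEq, Nat.mul_left_inj hKne] at hzx
        rcases h1 with rfl | rfl <;> rw [mul_mem_segment_iff hK] at hz <;> omega
      · subst hzx
        rw [mul_mem_segment_iff hK] at hz
        omega
    · intro hinc
      refine ⟨(a, s / 2 * K), (mul_mem_segment_iff hK).2 ⟨rfl, by omega⟩, ?_⟩
      by_cases hs : s = 0
      · rw [hφ0 _ (by simp [hs])]
        ext <;> simp <;> omega
      by_cases hsh : s / 2 = h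
      · rw [hsh, hφh a (by omega)]
        ext <;> simp
        omega
      · rw [hφid]
        · ext <;> simp
          omega
        · have : s / 2 ≠ 0 := by omega
          simp [hKne]
          omega
        · simp only [Prod.mk.injEq, Nat.mul_left_inj hKne]
          omega
  · rintro ⟨a, i⟩ hy ⟨b, j⟩ hz v hne ⟨x, hx, rfl⟩ ⟨x', hx', hxx⟩
    have h00 : (0, 0) ∈ (fun x : ℕ × ℕ ↦ (x.1, x.2 / 2 * K)) '' thetaVerts (2 * h) :=
      ⟨(0, 0), ⟨rfl, by simp, by simp, fun _ ↦ rfl⟩, by simp⟩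
    have h0h : (0, h * K) ∈ (fun x : ℕ × ℕ ↦ (x.1, x.2 / 2 * K)) '' thetaVerts (2 * h) :=
      ⟨(0, 2 * h), ⟨by simp, by simp, by simp, fun _ ↦ rfl⟩, by simp⟩
    simp only [thetaEdges, Set.mem_ofPred_eq, ne_eq, Prod.mk.injEq] at *
    have hmid : ∀ a i j, a < 3 → i % 2 = 1 → j % 2 = 1 → j ≤ 2 * h → i / 2 < j / 2 →
        x ∈ segment K a (i / 2) → x ∈ segment K a (j / 2) →
        x ∈ (fun x : ℕ × ℕ ↦ (x.1, x.2 / 2 * K)) '' thetaVerts (2 * h) :=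
      fun a i j ha hi hj hjh hij h1 h2 ↦ by
        rw [eq_of_mem_segment h1 h2 hij]
        refine ⟨(a, j - 1), ⟨by dsimp only; omega, ha, by dsimp only; omega, by dsimp only; omega⟩,
          ?_⟩
        simp only [Prod.mk.injEq, true_and, Nat.mul_left_inj hKne]
        omega
    rcases hcases x with ⟨-, h2⟩ | ⟨-, h2⟩ | ⟨-, -, h2⟩
    · rwa [h2]
    · rwa [h2]
    rcases hcases x' with ⟨-, h2'⟩ | ⟨-, h2'⟩ | ⟨-, -, h2'⟩
    · rwa [← hxx, h2']
    · rwa [← hxx, h2']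
    rw [h2]
    rw [h2, h2'] at hxx
    subst hxx
    obtain rfl : a = b := hx.1.symm.trans hx'.1
    rcases lt_trichotomy (i / 2) (j / 2) with hij | hij | hij
    · exact hmid a i j (by omega) (by omega) (by omega) (by omega) hij hx hx'
    · omega
    · exact hmid a j i (by omega) (by omega) (by omega) (by omega) hij hx' hx
  · rintro ⟨a, i⟩ hy
    rw [Set.InjOn.encard_image, segment_encard]
    rintro ⟨b, z⟩ ⟨rfl, -⟩ ⟨c, z'⟩ ⟨hc, -⟩ hzz
    dsimp only at hc
    subst hc
    rcases hcases (c, z) with ⟨h1, h2⟩ | ⟨h1, h2⟩ | ⟨h1, h1', h2⟩ <;>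
    rcases hcases (c, z') with ⟨h3, h4⟩ | ⟨h3, h4⟩ | ⟨h3, h3', h4⟩ <;>
    rw [h2, h4] at hzz <;> simp only [Prod.mk.injEq] at * <;>
    have := Nat.mul_pos (show 0 < h by omega) hK <;> grind

-- The last edge of the second path, of length `h + 1`, plays the role of the far end `(0, 2 * h +
-- 1)`. Its three labelled vertices end three paths that all have `h` edges before it.
set_option maxHeartbeats 800000 in
lemma exists_isTheta_thetaC₂ {k h : ℕ} (t : ℕ) (hk : 3 ≤ k) (hh : 1 ≤ h) :
    ∃ γ ε, (thetaC₂ k h (h + 1) h t).IsTheta k (2 * h + 1) t γ ε := by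
  obtain ⟨K, rfl⟩ : ∃ K, k = K + 1 := ⟨k - 1, by omega⟩
  have hK : 0 < K := by omega
  have hKne : K ≠ 0 := hK.ne'
  have hhK := Nat.mul_pos hh hK
  -- `K ≥ 2` places position `h * K + 1` strictly between two consecutive path vertices.
  have hne1 : ∀ s, s * K ≠ h * K + 1 := fun s hs ↦ by
    have h1 : h * K < s * K := by omega
    have h2 := Nat.mul_le_mul_right K (show h + 1 ≤ s from Nat.lt_of_mul_lt_mul_right h1)
    rw [add_mul] at h2
    omega
  have hseg1 : ∀ a j, (1, h * K + 1) ∈ segment K a j ↔ a = 1 ∧ j = h := fun a j ↦ by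
    constructor
    · rintro ⟨h0, h1, h2⟩
      refine ⟨h0.symm, le_antisymm ?_ ?_⟩
      · by_contra hlt
        have := Nat.mul_le_mul_right K (show h + 1 ≤ j by omega)
        rw [add_mul] at this
        dsimp only at h1
        omega
      · by_contra hlt
        have := Nat.mul_le_mul_right K (show j + 1 ≤ h by omega)
        dsimp only at h2
        omega
    · rintro ⟨rfl, rfl⟩
      refine ⟨rfl, by simp, ?_⟩
      dsimp only
      rw [add_mul]
      omega
  set φ : ℕ × ℕ → ℕ × ℕ := fun x ↦ if x.2 = 0 then (0, 0)
    else if x = (1, (h + 1) * K) then (0, h * K)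
    else if x = (2, h * K) then (1, h * K + 1) else x with hφ
  have hφ0 : ∀ x : ℕ × ℕ, x.2 = 0 → φ x = (0, 0) := fun x hx ↦ by simp [hφ, hx]
  have hφ1 : φ (1, (h + 1) * K) = (0, h * K) := by simp [hφ, hKne]
  have hφ2 : φ (2, h * K) = (1, h * K + 1) := by
    simp [hφ, hKne]
    omega
  have hφid : ∀ x : ℕ × ℕ, x.2 ≠ 0 → x ≠ (1, (h + 1) * K) → x ≠ (2, h * K) → φ x = x :=
    fun x h1 h2 h3 ↦ by simp only [hφ, if_neg h1, if_neg h2, if_neg h3]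
  have hcases : ∀ x : ℕ × ℕ, x.2 = 0 ∧ φ x = (0, 0) ∨
      x = (1, (h + 1) * K) ∧ φ x = (0, h * K) ∨ x = (2, h * K) ∧ φ x = (1, h * K + 1) ∨
      x.2 ≠ 0 ∧ x ≠ (1, (h + 1) * K) ∧ x ≠ (2, h * K) ∧ φ x = x := fun x ↦ by
    by_cases h0 : x.2 = 0
    · exact .inl ⟨h0, hφ0 x h0⟩
    by_cases h1 : x = (1, (h + 1) * K)
    · exact .inr (.inl ⟨h1, h1 ▸ hφ1⟩)
    by_cases h2 : x = (2, h * K)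
    · exact .inr (.inr (.inl ⟨h2, h2 ▸ hφ2⟩))
    · exact .inr (.inr (.inr ⟨h0, h1, h2, hφid x h0 h1 h2⟩))
  have hlen : ∀ a, pathLength h (h + 1) h a = if a = 1 then h + 1 else if a < 3 then h else 1 :=
    fun a ↦ by
      unfold pathLength
      split_ifs <;> omega
  -- The last vertex of the third path has been identified with `(1, h * K + 1)`, which is not a
  -- multiple of `K` along its path; hence the exceptional value.
  set γ : ℕ × ℕ → ℕ × ℕ := fun x ↦ if x = (2, 2 * h) then (1, h * K + 1) else (x.1, x.2 / 2 * K)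
    with hγ
  have hγ2 : γ (2, 2 * h) = (1, h * K + 1) := by simp [hγ]
  have hγid : ∀ x, x ≠ (2, 2 * h) → γ x = (x.1, x.2 / 2 * K) := fun x hx ↦ by
    simp only [hγ, if_neg hx]
  have hH : thetaC₂ (K + 1) h (h + 1) h t =
      (disjointPaths (K + 1) ([h, h + 1, h] ++ List.replicate t 1)).image φ := rfl
  rw [hH]
  clear_value φ γ
  clear hφ hγ hH
  -- The far end carries path index 0 as a label but is edge number `h` of path 1.
  refine ⟨γ, fun y ↦ φ '' segment K (if y.2 = 2 * h + 1 then 1 else y.1) (y.2 / 2),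
    isTheta_of_image_eq (by omega) (by omega) ?_ ?_ ?_ ?_
      (exists_mem_image_disjointPaths (by omega) (by omega) (by omega) (by omega) _) ?_⟩
  · intro x hx x' hx' hxx
    by_cases h1 : x = (2, 2 * h) <;> by_cases h2 : x' = (2, 2 * h)
    · rw [h1, h2]
    · rw [h1, hγ2, hγid x' h2, Prod.mk.injEq] at hxx
      exact absurd hxx.2.symm (hne1 _)
    · rw [h2, hγ2, hγid x h1, Prod.mk.injEq] at hxx
      exact absurd hxx.2 (hne1 _)
    · rw [hγid x h1, hγid x' h2, Prod.mk.injEq, Nat.mul_left_inj hKne] at hxx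
      have := hx.1
      have := hx'.1
      ext <;> omega
  · change _ = Set.image φ '' E(disjointPaths _ _)
    rw [edgeSet_disjointPaths, Nat.add_sub_cancel]
    ext e
    constructor
    · rintro ⟨⟨a, i⟩, ⟨hi, hai⟩, rfl⟩
      dsimp only at hi hai
      refine Set.mem_image_of_mem _ ⟨_, i / 2, ?_, ?_, rfl⟩
      · dsimp only
        split_ifs <;> omega
      · rw [hlen]
        dsimp only
        split_ifs <;> omega
    · rintro ⟨_, ⟨a, j, ha, hj, rfl⟩, rfl⟩
      rw [hlen] at hj
      by_cases hah : a = 1 ∧ j = h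
      · refine ⟨(0, 2 * h + 1), ⟨by dsimp only; omega, .inl (by simp)⟩, ?_⟩
        dsimp only
        rw [if_pos rfl, hah.1, hah.2, show (2 * h + 1) / 2 = h by omega]
      · refine ⟨(a, 2 * j + 1), ⟨by dsimp only; omega, ?_⟩, ?_⟩
        · dsimp only
          split_ifs at hj <;> omega
        · dsimp only
          rw [show (2 * j + 1) / 2 = j by omega, if_neg]
          split_ifs at hj <;> omega
  · rintro x hx ⟨a, i⟩ hy
    constructor
    · rintro ⟨z, hz, hzx⟩
      by_cases hxs : x = (2, 2 * h)
      · subst hxs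
        rw [hγ2] at hzx
        simp only [thetaVerts, thetaEdges, ThetaInc, Set.mem_ofPred_eq] at *
        rcases hcases z with ⟨h1, h2⟩ | ⟨h1, h2⟩ | ⟨h1, h2⟩ | ⟨h1, h1', h1'', h2⟩ <;> rw [h2] at hzx
        · simp at hzx
        · simp at hzx
        · rw [h1, mul_mem_segment_iff hK] at hz
          grind
        · rw [hzx, hseg1] at hz
          grind
      · rw [hγid x hxs] at hzx
        obtain ⟨b, s⟩ := x
        simp only [thetaVerts, thetaEdges, ThetaInc, Set.mem_ofPred_eq, ne_eq, Prod.mk.injEq] at *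
        rcases hcases z with ⟨h1, h2⟩ | ⟨h1, h2⟩ | ⟨h1, h2⟩ | ⟨h1, h1', h1'', h2⟩ <;> rw [h2] at hzx
        · simp only [Prod.mk.injEq, zero_eq_mul, hKne, or_false] at hzx
          have hz' : z = (z.1, 0 * K) := by ext <;> simp [h1]
          rw [hz', mul_mem_segment_iff hK] at hz
          have := hz.2
          omega
        · simp only [Prod.mk.injEq, Nat.mul_left_inj hKne] at hzx
          rw [h1, mul_mem_segment_iff hK] at hz
          split_ifs at hz <;> omega
        · simp only [Prod.mk.injEq] at hzx
          exact absurd hzx.2.symm (hne1 _)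
        · subst hzx
          rw [mul_mem_segment_iff hK] at hz
          split_ifs at hz <;> omega
    · intro hinc
      by_cases hxs : x = (2, 2 * h)
      · subst hxs
        rw [hγ2]
        simp only [thetaVerts, thetaEdges, ThetaInc, Set.mem_ofPred_eq] at *
        by_cases hi : i = 2 * h + 1
        · refine ⟨(1, h * K + 1), ?_, hφid _ (by simp) ?_ (by simp)⟩
          · rw [if_pos hi, hseg1]
            omega
          · intro heq
            rw [Prod.mk.injEq] at heq
            exact hne1 _ heq.2.symm
        · refine ⟨(2, h * K), ?_, hφ2⟩
          rw [if_neg hi, mul_mem_segment_iff hK]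
          omega
      · rw [hγid x hxs]
        obtain ⟨b, s⟩ := x
        simp only [thetaVerts, thetaEdges, ThetaInc, Set.mem_ofPred_eq, ne_eq, Prod.mk.injEq] at *
        by_cases hs : s = 0
        · refine ⟨(a, 0 * K), ?_, ?_⟩
          · rw [mul_mem_segment_iff hK]
            split_ifs <;> omega
          · rw [hφ0 _ (by simp)]
            ext <;> simp <;> omega
        by_cases hbi : b = 0 ∧ i = 2 * h + 1
        · refine ⟨(1, (h + 1) * K), ?_, ?_⟩
          · rw [if_pos hbi.2, mul_mem_segment_iff hK]
            omega
          · rw [hφ1]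
            simp only [Prod.mk.injEq, Nat.mul_left_inj hKne]
            omega
        · refine ⟨(b, s / 2 * K), ?_, hφid _ ?_ ?_ ?_⟩
          · rw [mul_mem_segment_iff hK]
            split_ifs <;> omega
          · have : s / 2 ≠ 0 := by omega
            simp [hKne]
            omega
          · simp only [Prod.mk.injEq, Nat.mul_left_inj hKne]
            omega
          · simp only [Prod.mk.injEq, Nat.mul_left_inj hKne]
            omega
  · rintro ⟨a, i⟩ hy ⟨b, j⟩ hz v hne ⟨x, hx, rfl⟩ ⟨x', hx', hxx⟩
    have h00 : (0, 0) ∈ γ '' thetaVerts (2 * h + 1) :=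
      ⟨(0, 0), ⟨rfl, by simp, by simp, fun _ ↦ rfl⟩, by rw [hγid _ (by simp)]; simp⟩
    have h0h : (0, h * K) ∈ γ '' thetaVerts (2 * h + 1) :=
      ⟨(0, 2 * h), ⟨by simp, by simp, by simp, fun _ ↦ rfl⟩, by rw [hγid _ (by simp)]; simp⟩
    have h1h : (1, h * K + 1) ∈ γ '' thetaVerts (2 * h + 1) :=
      ⟨(2, 2 * h), ⟨by simp, by simp, by simp, by dsimp only; omega⟩, hγ2⟩
    simp only [thetaEdges, Set.mem_ofPred_eq, ne_eq, Prod.mk.injEq] at *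
    have hmid : ∀ a i j, a < 3 → i < j → j < pathLength h (h + 1) h a →
        x ∈ segment K a i → x ∈ segment K a j → x ∈ γ '' thetaVerts (2 * h + 1) :=
      fun a i j ha hij hjh h1 h2 ↦ by
        rw [eq_of_mem_segment h1 h2 hij]
        rw [hlen] at hjh
        refine ⟨(a, 2 * j), ⟨by simp, ha, ?_, ?_⟩, ?_⟩
        · dsimp only
          split_ifs at hjh <;> omega
        · dsimp only
          split_ifs at hjh <;> omega
        · rw [hγid]
          · simp
          · simp only [Prod.mk.injEq]
            split_ifs at hjh <;> omega
    rcases hcases x with ⟨-, h2⟩ | ⟨-, h2⟩ | ⟨-, h2⟩ | ⟨-, -, -, h2⟩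
    · rwa [h2]
    · rwa [h2]
    · rwa [h2]
    rcases hcases x' with ⟨-, h2'⟩ | ⟨-, h2'⟩ | ⟨-, h2'⟩ | ⟨-, -, -, h2'⟩
    · rwa [← hxx, h2']
    · rwa [← hxx, h2']
    · rwa [← hxx, h2']
    rw [h2]
    rw [h2, h2'] at hxx
    subst hxx
    have hab := hx.1.symm.trans hx'.1
    rw [← hab] at hx'
    generalize hc : (if i = 2 * h + 1 then 1 else a) = c at hx hx' hab
    rcases lt_trichotomy (i / 2) (j / 2) with hij | hij | hij
    · refine hmid c _ _ ?_ hij ?_ hx hx'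
      · split_ifs at hc hab <;> omega
      · rw [hlen]
        split_ifs at hc hab ⊢ <;> omega
    · split_ifs at hc hab <;> omega
    · refine hmid c _ _ ?_ hij ?_ hx' hx
      · split_ifs at hc hab <;> omega
      · rw [hlen]
        split_ifs at hc hab ⊢ <;> omega
  · rintro ⟨a, i⟩ hy
    rw [Set.InjOn.encard_image, segment_encard]
    rintro ⟨b, z⟩ ⟨hb, -, hz⟩ ⟨c, z'⟩ ⟨hc, -, hz'⟩ hzz
    dsimp only at hb hc
    obtain rfl := hb.trans hc.symm
    rcases hcases (b, z) with ⟨h1, h2⟩ | ⟨h1, h2⟩ | ⟨h1, h2⟩ | ⟨h1, h1', h1'', h2⟩ <;>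
    rcases hcases (b, z') with ⟨h3, h4⟩ | ⟨h3, h4⟩ | ⟨h3, h4⟩ | ⟨h3, h3', h3'', h4⟩ <;>
    rw [h2, h4] at hzz <;> simp only [Prod.mk.injEq] at * <;> grind

end Hypergraph

/-! ### The Zagreb bound for hypergraphs, and the theorem. -/

namespace Hypergraph

lemma isTheta_of_inc {α : Type*} {H : Hypergraph α} {k g t : ℕ} {γ : ℕ × ℕ → V(H)}
    {ε : ℕ × ℕ → E(H)} (h : Incidence.IsTheta H.Inc g t γ ε) (hU : H.IsUniform k)
    (hpos : ∀ v ∈ V(H), ∃ e ∈ E(H), v ∈ e) :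
    H.IsTheta k g t (fun x ↦ γ x) (fun y ↦ ε y) where
  injOn x hx x' hx' hxx := h.injOn hx hx' (Subtype.ext hxx)
  bijOn := by
    refine ⟨fun y _ ↦ (ε y).2, fun y hy z hz hyz ↦ h.bijOn.injOn hy hz (Subtype.ext hyz),
      fun e he ↦ ?_⟩
    obtain ⟨y, hy, hye⟩ := h.bijOn.surjOn (Set.mem_univ (⟨e, he⟩ : E(H)))
    exact ⟨y, hy, congrArg Subtype.val hye⟩
  mem_iff := h.inc_iff
  mem_image e he f hf v hne hve hvf := by
    obtain ⟨x, hx, hxv⟩ := h.mem_image ⟨e, he⟩ ⟨f, hf⟩ ⟨v, mem_vertexSet_of_mem_edgeSet he hve⟩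
      (fun heq ↦ hne (congrArg Subtype.val heq)) hve hvf
    exact ⟨x, hx, congrArg Subtype.val hxv⟩
  exists_mem := hpos
  isUniform := hU

/-- The bound on the Zagreb index of bicyclic hypergraphs of girth at least `g`, with the case of
equality. -/
lemma IsBicyclic.zagreb_le {α : Type*} {H : Hypergraph α} {k n m g : ℕ} (h : H.IsBicyclic k n m)
    (hk : 3 ≤ k) (hg : ∀ l, H.HasHypercycle l → g ≤ l) (h3 : 3 ≤ g) (hm : 2 * g ≤ m) :
    H.zagreb + 2 * (g % 2) ≤ (m - 3 * g / 2 + 2) ^ 2 + 3 * g / 2 + 1 + 2 * (m + 1) + n ∧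
    (H.zagreb + 2 * (g % 2) = (m - 3 * g / 2 + 2) ^ 2 + 3 * g / 2 + 1 + 2 * (m + 1) + n →
      ∃ γ ε, H.IsTheta k g (m - 3 * g / 2) γ ε) := by
  have := (Set.finite_of_encard_eq_coe h.encard_edgeSet).fintype
  have := (Set.finite_of_encard_eq_coe h.encard_vertexSet).fintype
  have hcardE := h.encard_edgeSet
  have hcardV := h.encard_vertexSet
  rw [Set.encard_eq_coe_toFinset_card, Set.toFinset_card] at hcardE hcardV
  norm_cast at hcardE hcardV
  have hcard := h.card_eq
  have hV : V(H).Nontrivial := by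
    rw [← Set.one_lt_encard_iff_nontrivial, h.encard_vertexSet]
    have : 1 < n := by
      zify
      rw [hcard]
      have h1 : (2 : ℤ) ≤ k - 1 := by omega
      have h2 : (6 : ℤ) ≤ m := by omega
      nlinarith
    exact_mod_cast this
  have hpos := h.isConnected.degree_pos hV
  have hconn := h.isConnected.connected_inc fun e he ↦ by
    rw [← Set.encard_pos, h.isUniform e he]
    exact_mod_cast (by omega : 0 < k)
  have hex : Incidence.excess H.Inc Finset.univ = Fintype.card E(H) + 1 := by
    have h1 := h.isUniform.excess_add_card hpos
    rw [hcardE, hcardV] at *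
    zify at h1 ⊢
    linarith
  have hz := zagreb_eq hpos
  rw [hex, hcardV, hcardE] at hz
  obtain ⟨hle, heq⟩ := Incidence.sum_sq_le_and_exists_isExtremal hconn hex (girthGE_inc hg) h3
    (by rwa [hcardE])
  rw [hcardE] at hle heq
  rw [hz]
  refine ⟨by omega, fun hzeq ↦ ?_⟩
  obtain ⟨C, w, hC⟩ := heq (by omega)
  obtain ⟨γ, ε, hθ⟩ := hC.exists_isTheta (girthGE_inc hg) h3 hconn fun v ↦ by
    rw [deg_inc]
    exact hpos v
  rw [hcardE] at hθ
  refine ⟨_, _, isTheta_of_inc hθ h.isUniform fun v hv ↦ ?_⟩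
  have := hpos ⟨v, hv⟩
  rw [← deg_inc, Incidence.deg_pos_iff] at this
  obtain ⟨e, -, hve⟩ := this
  exact ⟨e, e.2, hve⟩

/-- Theta hypergraphs maximize the Zagreb index among the bicyclic hypergraphs of girth at least
`g`. -/
lemma IsTheta.zagreb_le_and_isIso {α β : Type*} {T : Hypergraph β} {H : Hypergraph α}
    {k n m g : ℕ} {γ : ℕ × ℕ → β} {ε : ℕ × ℕ → Set β} (hT : T.IsTheta k g (m - 3 * g / 2) γ ε)
    (h : H.IsBicyclic k n m) (hk : 3 ≤ k) (hg : ∀ l, H.HasHypercycle l → g ≤ l) (h3 : 3 ≤ g)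
    (hm : 2 * g ≤ m) : H.zagreb ≤ T.zagreb ∧ (H.zagreb = T.zagreb → T.IsIso H) := by
  obtain ⟨hle, heq⟩ := h.zagreb_le hk hg h3 hm
  have hTz := hT.zagreb_add h3 (m := m) (by omega) h.card_eq
  refine ⟨by omega, fun hz ↦ ?_⟩
  obtain ⟨γ', ε', hH⟩ := heq (by omega)
  exact hT.isIso h3 hH

end Hypergraph

theorem theorem3p5 (k n m : ℕ) (hk : 3 ≤ k) (hn : (n : ℤ) = m * (k - 1) - 1) :
    (∀ g : ℕ, 3 ≤ g → 2 * g ≤ m → Even g →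
      (Hypergraph.thetaC₁ k (g / 2) (g / 2) (g / 2) (m - 3 * (g / 2))).IsBicyclic k n m ∧
      (Hypergraph.thetaC₁ k (g / 2) (g / 2) (g / 2) (m - 3 * (g / 2))).IsLinear ∧
      (Hypergraph.thetaC₁ k (g / 2) (g / 2) (g / 2) (m - 3 * (g / 2))).HasGirth g ∧
      ∀ (α : Type*) (H : Hypergraph α), H.IsBicyclic k n m → H.IsLinear → H.HasGirth g →
        H.zagreb ≤ (Hypergraph.thetaC₁ k (g / 2) (g / 2) (g / 2) (m - 3 * (g / 2))).zagreb ∧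
        (H.zagreb = (Hypergraph.thetaC₁ k (g / 2) (g / 2) (g / 2) (m - 3 * (g / 2))).zagreb →
          (Hypergraph.thetaC₁ k (g / 2) (g / 2) (g / 2) (m - 3 * (g / 2))).IsIso H)) ∧
    (∀ g : ℕ, 3 ≤ g → 2 * g ≤ m → Odd g →
      (Hypergraph.thetaC₂ k (g / 2) ((g + 1) / 2) (g / 2) (m - g - g / 2)).IsBicyclic k n m ∧
      (Hypergraph.thetaC₂ k (g / 2) ((g + 1) / 2) (g / 2) (m - g - g / 2)).IsLinear ∧
      (Hypergraph.thetaC₂ k (g / 2) ((g + 1) / 2) (g / 2) (m - g - g / 2)).HasGirth g ∧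
      ∀ (α : Type*) (H : Hypergraph α), H.IsBicyclic k n m → H.IsLinear → H.HasGirth g →
        H.zagreb ≤ (Hypergraph.thetaC₂ k (g / 2) ((g + 1) / 2) (g / 2) (m - g - g / 2)).zagreb ∧
        (H.zagreb = (Hypergraph.thetaC₂ k (g / 2) ((g + 1) / 2) (g / 2) (m - g - g / 2)).zagreb →
          (Hypergraph.thetaC₂ k (g / 2) ((g + 1) / 2) (g / 2) (m - g - g / 2)).IsIso H)) ∧
    (6 ≤ m →
      (Hypergraph.thetaC₂ k 1 2 1 (m - 4)).IsBicyclic k n m ∧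
      (Hypergraph.thetaC₂ k 1 2 1 (m - 4)).IsLinear ∧
      ∀ (α : Type*) (H : Hypergraph α), H.IsBicyclic k n m → H.IsLinear →
        H.zagreb ≤ (Hypergraph.thetaC₂ k 1 2 1 (m - 4)).zagreb ∧
        (H.zagreb = (Hypergraph.thetaC₂ k 1 2 1 (m - 4)).zagreb →
          (Hypergraph.thetaC₂ k 1 2 1 (m - 4)).IsIso H)) := by
  refine ⟨fun g h3 hm he ↦ ?_, fun g h3 hm ho ↦ ?_, fun hm ↦ ?_⟩
  · have h2 := Nat.even_iff.1 he
    obtain ⟨γ, ε, hT⟩ := Hypergraph.exists_isTheta_thetaC₁ (k := k) (h := g / 2)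
      (m - 3 * (g / 2)) hk (by omega)
    have ht : m - 3 * (g / 2) = m - 3 * g / 2 := by omega
    rw [show 2 * (g / 2) = g by omega] at hT
    refine ⟨hT.isBicyclic h3 (by omega) hn, hT.isLinear h3, hT.hasGirth h3, fun α H hB _ hg ↦ ?_⟩
    rw [ht] at hT ⊢
    exact hT.zagreb_le_and_isIso hB hk (fun l hl ↦ hg.2 hl) h3 hm
  · have h2 := Nat.odd_iff.1 ho
    obtain ⟨γ, ε, hT⟩ := Hypergraph.exists_isTheta_thetaC₂ (k := k) (h := g / 2)
      (m - g - g / 2) hk (by omega)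
    have ht : m - g - g / 2 = m - 3 * g / 2 := by omega
    rw [show 2 * (g / 2) + 1 = g by omega, show g / 2 + 1 = (g + 1) / 2 by omega] at hT
    refine ⟨hT.isBicyclic h3 (by omega) hn, hT.isLinear h3, hT.hasGirth h3, fun α H hB _ hg ↦ ?_⟩
    rw [ht] at hT ⊢
    exact hT.zagreb_le_and_isIso hB hk (fun l hl ↦ hg.2 hl) h3 hm
  -- The case `g = 3`, where `3 * g / 2 = 4`: linearity alone guarantees that every hypercycle has
  -- length at least 3.
  · obtain ⟨γ, ε, hT⟩ := Hypergraph.exists_isTheta_thetaC₂ (k := k) (h := 1) (m - 4) hk le_rfl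
    exact ⟨hT.isBicyclic le_rfl (by omega) hn, hT.isLinear le_rfl, fun α H hB hL ↦
      hT.zagreb_le_and_isIso hB hk (fun l hl ↦ hL.three_le hl) le_rfl hm⟩
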